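/- All spaces are complex. An operator space is a Banach space $V$ with a fixed linear isometric embedding $V\subseteq B(H)$ into the bounded operators on a Hilbert space $H$, which determines the norms of matrices over $V$. For operator spaces $V\subseteq B(H)$ and $W\subseteq B(K)$, the Haagerup tensor product $V\otimes_h W$ is the completion of the algebraic tensor product $V\otimes W$ in the norm $$\|u\|_h=\inf\Big\{\Big\|\sum_{i=1}^n v_iv_i^*\Big\|^{1/2}\Big\|\sum_{i=1}^n w_i^*w_i\Big\|^{1/2} : u=\sum_{i=1}^n v_i\otimes w_i\Big\}.$$ For $\phi\in V^*$ let $R_\phi:V\otimes_hW\to W$ be the continuous linear extension of $v\otimes w\mapsto\phi(v)w$, and for $\psi\in W^*$ let $L_\psi:V\otimes_hW\to V$ be the continuous linear extension of $v\otimes w\mapsto\psi(w)v$. A Banach $*$-algebra is a (not necessarily unital) complex Banach algebra $A$ with an involution satisfying $\|x^*\|=\|x\|$. It is reduced if for every $a\neq0$ in $A$ there is a $*$-representation $\pi$ of $A$ on a Hilbert space with $\pi(a)\neq0$. An approximate identity of $A$ is a net $(e_\lambda)$ in $A$ (not assumed bounded) with $e_\lambda x\to x$ and $xe_\lambda\to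 x$ for all $x\in A$. A continuous linear form $f$ on $A$ is positive if $f(x^*x)\ge0$ for all $x\in A$; a pure state of $A$ is a continuous positive form $f$ with $\|f\|=1$ such that every continuous positive form $g$ on $A$ for which $f-g$ is positive is of the form $g=tf$ with $0\le t\le1$. The set of pure states is denoted by $P(A)$. **Proposition.** Let $V$ and $W$ be operator spaces. The family $\{R_\phi:\phi\in V^*\}$ separates the points of $V\otimes_hW$, and so does the family $\{L_\psi:\psi\in W^*\}$. **Corollary 1.** Let $V$ be an operator space whose underlying Banach space is a reduced Banach $*$-algebra with approximate identity, and let $W$ be any operator space (for instance any Banach algebra with an operator space structure). Then $\{R_\phi:\phi\in P(V)\}$ separates the points of $V\otimes_hW$. **Corollary 2.** Let $V$ be any operator space (for instance any Banach algebra with an operator space structure), and let $W$ be an operator space whose underlying Banach space is a reduced Banach $*$-algebra with approximate identity. Then $\{L_\psi:\psi\in P(W)\}$ separates the points of $V\otimes_hW$. -/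

import Mathlib

open scoped TensorProduct

noncomputable section

namespace Haagerup

/-- An operator space structure on a complex normed space `V`, given by a linear isometric embedding
of `V` into the bounded operators on a Hilbert space `H`.  The norms of all matrices over `V` are the
ones inherited from this embedding. -/
abbrev OperatorSpaceStructure (V H : Type*) [NormedAddCommGroup V] [NormedSpace ℂ V]
    [NormedAddCommGroup H] [InnerProductSpace ℂ H] [CompleteSpace H] : Type _ :=
  V →ₗᵢ[ℂ] (H →L[ℂ] H)

section Norms

variable {V W H K : Type*}
  [NormedAddCommGroup V] [NormedSpace ℂ V] [NormedAddCommGroup W] [NormedSpace ℂ W]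
  [NormedAddCommGroup H] [InnerProductSpace ℂ H] [CompleteSpace H]
  [NormedAddCommGroup K] [InnerProductSpace ℂ K] [CompleteSpace K]

/-- `‖∑ vᵢ vᵢ*‖^{1/2}`, the norm of the row `(v₁, …, vₙ)`. -/
def rowNorm (jV : OperatorSpaceStructure V H) {n : ℕ} (v : Fin n → V) : ℝ :=
  Real.sqrt ‖∑ i, jV (v i) * star (jV (v i))‖

/-- `‖∑ wᵢ* wᵢ‖^{1/2}`, the norm of the column `(w₁, …, wₙ)`. -/
def colNorm (jW : OperatorSpaceStructure W K) {n : ℕ} (w : Fin n → W) : ℝ :=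
  Real.sqrt ‖∑ i, star (jW (w i)) * jW (w i)‖

/-- The Haagerup norm on the algebraic tensor product. -/
def haagerupNorm (jV : OperatorSpaceStructure V H) (jW : OperatorSpaceStructure W K)
    (u : V ⊗[ℂ] W) : ℝ :=
  sInf {r : ℝ | ∃ (n : ℕ) (v : Fin n → V) (w : Fin n → W),
    u = ∑ i, v i ⊗ₜ[ℂ] w i ∧ r = rowNorm jV v * colNorm jW w}

theorem rowNorm_nonneg (jV : OperatorSpaceStructure V H) {n : ℕ} (v : Fin n → V) :
    0 ≤ rowNorm jV v := Real.sqrt_nonneg _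

theorem colNorm_nonneg (jW : OperatorSpaceStructure W K) {n : ℕ} (w : Fin n → W) :
    0 ≤ colNorm jW w := Real.sqrt_nonneg _

theorem rowNorm_smul (jV : OperatorSpaceStructure V H) {n : ℕ} (c : ℂ) (v : Fin n → V) :
    rowNorm jV (fun i => c • v i) = ‖c‖ * rowNorm jV v := by
  have h : ∑ i, jV (c • v i) * star (jV (c • v i))
      = (c * star c) • ∑ i, jV (v i) * star (jV (v i)) := by
    rw [Finset.smul_sum]
    refine Finset.sum_congr rfl fun i _ => ?_
    rw [map_smul, star_smul, smul_mul_smul_comm]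
  rw [rowNorm, h, norm_smul, Real.sqrt_mul (norm_nonneg _), norm_mul, norm_star,
    Real.sqrt_mul_self (norm_nonneg _), rowNorm]

theorem colNorm_smul (jW : OperatorSpaceStructure W K) {n : ℕ} (c : ℂ) (w : Fin n → W) :
    colNorm jW (fun i => c • w i) = ‖c‖ * colNorm jW w := by
  have h : ∑ i, star (jW (c • w i)) * jW (c • w i)
      = (star c * c) • ∑ i, star (jW (w i)) * jW (w i) := by
    rw [Finset.smul_sum]
    refine Finset.sum_congr rfl fun i _ => ?_
    rw [map_smul, star_smul, smul_mul_smul_comm]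
  rw [colNorm, h, norm_smul, Real.sqrt_mul (norm_nonneg _), norm_mul, norm_star,
    Real.sqrt_mul_self (norm_nonneg _), colNorm]

theorem rowNorm_append_sq_le (jV : OperatorSpaceStructure V H) {m n : ℕ} (v : Fin m → V)
    (v' : Fin n → V) :
    rowNorm jV (Fin.append v v') ^ 2 ≤ rowNorm jV v ^ 2 + rowNorm jV v' ^ 2 := by
  simp only [rowNorm, Real.sq_sqrt (norm_nonneg _), Fin.sum_univ_add, Fin.append_left,
    Fin.append_right]
  exact norm_add_le _ _

theorem colNorm_append_sq_le (jW : OperatorSpaceStructure W K) {m n : ℕ} (w : Fin m → W)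
    (w' : Fin n → W) :
    colNorm jW (Fin.append w w') ^ 2 ≤ colNorm jW w ^ 2 + colNorm jW w' ^ 2 := by
  simp only [colNorm, Real.sq_sqrt (norm_nonneg _), Fin.sum_univ_add, Fin.append_left,
    Fin.append_right]
  exact norm_add_le _ _

theorem exists_rep (u : V ⊗[ℂ] W) :
    ∃ (n : ℕ) (v : Fin n → V) (w : Fin n → W), u = ∑ i, v i ⊗ₜ[ℂ] w i := by
  induction u with
  | zero => exact ⟨0, 0, 0, by simp⟩
  | tmul v w => exact ⟨1, fun _ => v, fun _ => w, by simp⟩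
  | add x y hx hy =>
    obtain ⟨m, v, w, rfl⟩ := hx
    obtain ⟨n, v', w', rfl⟩ := hy
    exact ⟨m + n, Fin.append v v', Fin.append w w', by
      simp only [Fin.sum_univ_add, Fin.append_left, Fin.append_right]⟩

theorem haagerupNorm_le (jV : OperatorSpaceStructure V H) (jW : OperatorSpaceStructure W K)
    {n : ℕ} (v : Fin n → V) (w : Fin n → W) :
    haagerupNorm jV jW (∑ i, v i ⊗ₜ[ℂ] w i) ≤ rowNorm jV v * colNorm jW w := by
  refine csInf_le ⟨0, ?_⟩ ⟨n, v, w, rfl, rfl⟩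
  rintro r ⟨n, v, w, -, rfl⟩
  exact mul_nonneg (rowNorm_nonneg _ _) (colNorm_nonneg _ _)

theorem le_haagerupNorm (jV : OperatorSpaceStructure V H) (jW : OperatorSpaceStructure W K)
    (u : V ⊗[ℂ] W) (c : ℝ)
    (h : ∀ (n : ℕ) (v : Fin n → V) (w : Fin n → W), u = ∑ i, v i ⊗ₜ[ℂ] w i →
      c ≤ rowNorm jV v * colNorm jW w) : c ≤ haagerupNorm jV jW u := by
  obtain ⟨n, v, w, hu⟩ := exists_rep u
  refine le_csInf ⟨_, n, v, w, hu, rfl⟩ ?_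
  rintro r ⟨n, v, w, hu, rfl⟩
  exact h n v w hu

theorem haagerupNorm_nonneg (jV : OperatorSpaceStructure V H) (jW : OperatorSpaceStructure W K)
    (u : V ⊗[ℂ] W) : 0 ≤ haagerupNorm jV jW u :=
  le_haagerupNorm _ _ _ _ fun _ _ _ _ => mul_nonneg (rowNorm_nonneg _ _) (colNorm_nonneg _ _)

theorem haagerupNorm_zero (jV : OperatorSpaceStructure V H) (jW : OperatorSpaceStructure W K) :
    haagerupNorm jV jW 0 = 0 := by
  refine le_antisymm ?_ (haagerupNorm_nonneg _ _ _)
  have h := haagerupNorm_le jV jW (n := 0) 0 0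
  simpa [rowNorm] using h

theorem haagerupNorm_smul_le (jV : OperatorSpaceStructure V H) (jW : OperatorSpaceStructure W K)
    (c : ℂ) (u : V ⊗[ℂ] W) : haagerupNorm jV jW (c • u) ≤ ‖c‖ * haagerupNorm jV jW u := by
  rcases eq_or_ne c 0 with rfl | hc
  · simp [haagerupNorm_zero]
  have hc' : 0 < ‖c‖ := norm_pos_iff.mpr hc
  rw [← div_le_iff₀' hc']
  refine le_haagerupNorm _ _ _ _ fun n v w hu => ?_
  rw [div_le_iff₀' hc', ← mul_assoc, ← rowNorm_smul, hu, Finset.smul_sum]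
  simp only [TensorProduct.smul_tmul']
  exact haagerupNorm_le _ _ _ _

/-- Rescaling: if the Haagerup norm is less than `r`, there is a representation whose row and
column both have squared norm at most `r`. -/
theorem exists_balanced_rep (jV : OperatorSpaceStructure V H) (jW : OperatorSpaceStructure W K)
    (u : V ⊗[ℂ] W) (r : ℝ) (hr : haagerupNorm jV jW u < r) :
    ∃ (n : ℕ) (v : Fin n → V) (w : Fin n → W), u = ∑ i, v i ⊗ₜ[ℂ] w i ∧
      rowNorm jV v ^ 2 ≤ r ∧ colNorm jW w ^ 2 ≤ r := by
  have hr0 : 0 < r := (haagerupNorm_nonneg _ _ _).trans_lt hr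
  obtain ⟨n, v, w, hu, hlt⟩ : ∃ (n : ℕ) (v : Fin n → V) (w : Fin n → W),
      u = ∑ i, v i ⊗ₜ[ℂ] w i ∧ rowNorm jV v * colNorm jW w < r := by
    by_contra! hcon
    exact absurd (le_haagerupNorm jV jW u r hcon) (not_le.mpr hr)
  set a := rowNorm jV v with ha
  set b := colNorm jW w with hb
  have ha0 : 0 ≤ a := rowNorm_nonneg _ _
  have hb0 : 0 ≤ b := colNorm_nonneg _ _
  have hsr : 0 < Real.sqrt r := Real.sqrt_pos.mpr hr0
  have hsr2 : Real.sqrt r * Real.sqrt r = r := Real.mul_self_sqrt hr0.le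
  obtain ⟨s, hs, h1, h2⟩ : ∃ s : ℝ, 0 < s ∧ s * a ≤ Real.sqrt r ∧ s⁻¹ * b ≤ Real.sqrt r := by
    rcases ha0.eq_or_lt with h0 | hpos
    · refine ⟨(b + 1) / Real.sqrt r, by positivity, by rw [← h0]; simp [hsr.le], ?_⟩
      rw [inv_div, div_mul_eq_mul_div, div_le_iff₀ (by positivity)]
      exact mul_le_mul_of_nonneg_left (by linarith) hsr.le
    · refine ⟨Real.sqrt r / a, by positivity, by rw [div_mul_cancel₀ _ hpos.ne'], ?_⟩
      rw [inv_div, div_mul_eq_mul_div, div_le_iff₀ hsr, hsr2]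
      exact hlt.le
  have hsc : (s : ℂ) ≠ 0 := by exact_mod_cast hs.ne'
  refine ⟨n, fun i => (s : ℂ) • v i, fun i => (s : ℂ)⁻¹ • w i, ?_, ?_, ?_⟩
  · rw [hu]
    refine Finset.sum_congr rfl fun i _ => ?_
    rw [TensorProduct.smul_tmul, smul_smul, mul_inv_cancel₀ hsc, one_smul]
  · rw [rowNorm_smul, Complex.norm_real, Real.norm_of_nonneg hs.le, ← hsr2, ← sq]
    exact pow_le_pow_left₀ (by positivity) h1 2
  · rw [colNorm_smul, norm_inv, Complex.norm_real, Real.norm_of_nonneg hs.le, ← hsr2, ← sq]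
    exact pow_le_pow_left₀ (by positivity) h2 2

theorem haagerupNorm_add_le (jV : OperatorSpaceStructure V H) (jW : OperatorSpaceStructure W K)
    (x y : V ⊗[ℂ] W) :
    haagerupNorm jV jW (x + y) ≤ haagerupNorm jV jW x + haagerupNorm jV jW y := by
  refine le_of_forall_pos_le_add fun ε hε => ?_
  obtain ⟨m, v, w, hx, hv, hw⟩ := exists_balanced_rep jV jW x (haagerupNorm jV jW x + ε / 2)
    (by linarith)
  obtain ⟨n, v', w', hy, hv', hw'⟩ := exists_balanced_rep jV jW y (haagerupNorm jV jW y + ε / 2)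
    (by linarith)
  have hxy : x + y = ∑ i, Fin.append v v' i ⊗ₜ[ℂ] Fin.append w w' i := by
    simp only [Fin.sum_univ_add, Fin.append_left, Fin.append_right]
    rw [← hx, ← hy]
  have h := haagerupNorm_le jV jW (Fin.append v v') (Fin.append w w')
  rw [← hxy] at h
  have h1 := rowNorm_append_sq_le jV v v'
  have h2 := colNorm_append_sq_le jW w w'
  nlinarith [sq_nonneg (rowNorm jV (Fin.append v v') - colNorm jW (Fin.append w w'))]

/-- The algebraic tensor product `V ⊗ W`, regarded as carrying the Haagerup norm. -/
def AlgTensor (_jV : OperatorSpaceStructure V H) (_jW : OperatorSpaceStructure W K) : Type _ :=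
  V ⊗[ℂ] W

instance (jV : OperatorSpaceStructure V H) (jW : OperatorSpaceStructure W K) :
    AddCommGroup (AlgTensor jV jW) := inferInstanceAs (AddCommGroup (V ⊗[ℂ] W))

instance (jV : OperatorSpaceStructure V H) (jW : OperatorSpaceStructure W K) :
    Module ℂ (AlgTensor jV jW) := inferInstanceAs (Module ℂ (V ⊗[ℂ] W))

instance (jV : OperatorSpaceStructure V H) (jW : OperatorSpaceStructure W K) :
    SeminormedAddCommGroup (AlgTensor jV jW) :=
  { AddGroupSeminorm.toSeminormedAddCommGroup (E := AlgTensor jV jW)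
      (Seminorm.ofSMulLE (𝕜 := ℂ) (haagerupNorm jV jW) (haagerupNorm_zero jV jW)
        (haagerupNorm_add_le jV jW) (haagerupNorm_smul_le jV jW)).toAddGroupSeminorm with
    toAddCommGroup := inferInstanceAs (AddCommGroup (AlgTensor jV jW)) }

/-- The identification of `AlgTensor jV jW` with `V ⊗ W` (the identity map). -/
def AlgTensor.equiv (jV : OperatorSpaceStructure V H) (jW : OperatorSpaceStructure W K) :
    AlgTensor jV jW ≃ₗ[ℂ] V ⊗[ℂ] W :=
  LinearEquiv.refl ℂ (V ⊗[ℂ] W)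

theorem norm_algTensor (jV : OperatorSpaceStructure V H) (jW : OperatorSpaceStructure W K)
    (u : AlgTensor jV jW) : ‖u‖ = haagerupNorm jV jW (AlgTensor.equiv jV jW u) := rfl

instance (jV : OperatorSpaceStructure V H) (jW : OperatorSpaceStructure W K) :
    NormedSpace ℂ (AlgTensor jV jW) where
  norm_smul_le c u := haagerupNorm_smul_le jV jW c u

/-- The Haagerup tensor product `V ⊗_h W`. -/
abbrev HaagerupTensor (jV : OperatorSpaceStructure V H) (jW : OperatorSpaceStructure W K) :
    Type _ :=
  UniformSpace.Completion (AlgTensor jV jW)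

/-- The elementary tensor `v ⊗ w` in `V ⊗_h W`. -/
def tmul (jV : OperatorSpaceStructure V H) (jW : OperatorSpaceStructure W K) (v : V) (w : W) :
    HaagerupTensor jV jW :=
  (((AlgTensor.equiv jV jW).symm (v ⊗ₜ[ℂ] w) : AlgTensor jV jW) : HaagerupTensor jV jW)

/-! Boundedness of the slice maps on the algebraic tensor product. -/

theorem norm_sum_smul_le_col (jW : OperatorSpaceStructure W K) {n : ℕ} (c : Fin n → ℂ)
    (w : Fin n → W) : ‖∑ i, c i • w i‖ ≤ Real.sqrt (∑ i, ‖c i‖ ^ 2) * colNorm jW w := by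
  rw [← jW.norm_map]
  refine ContinuousLinearMap.opNorm_le_bound _
    (mul_nonneg (Real.sqrt_nonneg _) (colNorm_nonneg _ _)) fun x => ?_
  have h1 : ‖jW (∑ i, c i • w i) x‖ ≤ ∑ i, ‖c i‖ * ‖jW (w i) x‖ := by
    simp only [map_sum, map_smul, sum_apply, smul_apply]
    refine (norm_sum_le _ _).trans (le_of_eq ?_)
    exact Finset.sum_congr rfl fun i _ => norm_smul _ _
  have h2 : ∑ i, ‖c i‖ * ‖jW (w i) x‖
      ≤ Real.sqrt (∑ i, ‖c i‖ ^ 2) * Real.sqrt (∑ i, ‖jW (w i) x‖ ^ 2) :=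
    Real.sum_mul_le_sqrt_mul_sqrt _ _ _
  have h3 : ∑ i, ‖jW (w i) x‖ ^ 2 ≤ ‖∑ i, star (jW (w i)) * jW (w i)‖ * ‖x‖ ^ 2 := by
    have e : ((∑ i, ‖jW (w i) x‖ ^ 2 : ℝ) : ℂ)
        = inner ℂ ((∑ i, star (jW (w i)) * jW (w i)) x) x := by
      simp only [sum_apply, sum_inner, mul_apply_eq_comp,
        ContinuousLinearMap.star_eq_adjoint, ContinuousLinearMap.adjoint_inner_left,
        inner_self_eq_norm_sq_to_K]
      push_cast
      rfl
    have h4 : ‖((∑ i, ‖jW (w i) x‖ ^ 2 : ℝ) : ℂ)‖ = ∑ i, ‖jW (w i) x‖ ^ 2 := by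
      rw [Complex.norm_real, Real.norm_of_nonneg (Finset.sum_nonneg fun i _ => sq_nonneg _)]
    rw [← h4, e, sq, ← mul_assoc]
    refine (norm_inner_le_norm _ _).trans ?_
    exact mul_le_mul_of_nonneg_right (ContinuousLinearMap.le_opNorm _ _) (norm_nonneg _)
  have h5 : Real.sqrt (∑ i, ‖jW (w i) x‖ ^ 2) ≤ colNorm jW w * ‖x‖ := by
    refine (Real.sqrt_le_sqrt h3).trans (le_of_eq ?_)
    rw [Real.sqrt_mul (norm_nonneg _), Real.sqrt_sq (norm_nonneg _), colNorm]
  calc ‖jW (∑ i, c i • w i) x‖ ≤ _ := h1.trans h2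
    _ ≤ Real.sqrt (∑ i, ‖c i‖ ^ 2) * (colNorm jW w * ‖x‖) :=
        mul_le_mul_of_nonneg_left h5 (Real.sqrt_nonneg _)
    _ = _ := by ring

theorem norm_sum_smul_le_row (jV : OperatorSpaceStructure V H) {n : ℕ} (c : Fin n → ℂ)
    (v : Fin n → V) : ‖∑ i, c i • v i‖ ≤ Real.sqrt (∑ i, ‖c i‖ ^ 2) * rowNorm jV v := by
  -- the same estimate for the column of adjoints
  have h := norm_sum_smul_le_col (W := H →L[ℂ] H) (K := H) LinearIsometry.id
    (fun i => star (c i)) (fun i => star (jV (v i)))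
  have e : ∑ i, star (c i) • star (jV (v i)) = star (jV (∑ i, c i • v i)) := by
    simp [map_sum, star_sum, star_smul]
  rw [e, norm_star, jV.norm_map] at h
  simpa [colNorm, rowNorm] using h

theorem sqrt_sum_sq_le {n : ℕ} {X : Type*} [NormedAddCommGroup X] [NormedSpace ℂ X]
    (φ : StrongDual ℂ X) (v : Fin n → X) (R : ℝ) (hR : 0 ≤ R)
    (h : ∀ c : Fin n → ℂ, ‖∑ i, c i • v i‖ ≤ Real.sqrt (∑ i, ‖c i‖ ^ 2) * R) :
    Real.sqrt (∑ i, ‖φ (v i)‖ ^ 2) ≤ ‖φ‖ * R := by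
  set S := ∑ i, ‖φ (v i)‖ ^ 2 with hS
  have hS0 : 0 ≤ S := Finset.sum_nonneg fun i _ => sq_nonneg _
  have e : φ (∑ i, star (φ (v i)) • v i) = (S : ℂ) := by
    simp only [map_sum, map_smul, smul_eq_mul, hS]
    push_cast
    exact Finset.sum_congr rfl fun i _ => Complex.conj_mul' _
  have h1 : S ≤ ‖φ‖ * (Real.sqrt S * R) := by
    have h2 := φ.le_opNorm (∑ i, star (φ (v i)) • v i)
    rw [e, Complex.norm_real, Real.norm_of_nonneg hS0] at h2
    refine h2.trans (mul_le_mul_of_nonneg_left ?_ (norm_nonneg _))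
    simpa [hS] using h fun i => star (φ (v i))
  rcases (Real.sqrt_nonneg S).eq_or_lt with h0 | hpos
  · rw [← h0]; positivity
  · refine le_of_mul_le_mul_left ?_ hpos
    rw [Real.mul_self_sqrt hS0]
    linarith [h1]

theorem norm_le_mul_haagerupNorm (jV : OperatorSpaceStructure V H)
    (jW : OperatorSpaceStructure W K) (u : V ⊗[ℂ] W) (a C : ℝ) (hC : 0 ≤ C)
    (h : ∀ (n : ℕ) (v : Fin n → V) (w : Fin n → W), u = ∑ i, v i ⊗ₜ[ℂ] w i →
      a ≤ C * (rowNorm jV v * colNorm jW w)) : a ≤ C * haagerupNorm jV jW u := by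
  rcases hC.eq_or_lt with rfl | hpos
  · obtain ⟨n, v, w, hu⟩ := exists_rep u
    simpa using h n v w hu
  · rw [← div_le_iff₀' hpos]
    refine le_haagerupNorm jV jW u _ fun n v w hu => ?_
    rw [div_le_iff₀' hpos]
    exact h n v w hu

/-- `v ⊗ w ↦ φ(v) w` on the algebraic tensor product. -/
def rightSliceLin (φ : StrongDual ℂ V) : V ⊗[ℂ] W →ₗ[ℂ] W :=
  TensorProduct.lift ((LinearMap.lsmul ℂ W).comp (φ : V →ₗ[ℂ] ℂ))

/-- `v ⊗ w ↦ ψ(w) v` on the algebraic tensor product. -/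
def leftSliceLin (ψ : StrongDual ℂ W) : V ⊗[ℂ] W →ₗ[ℂ] V :=
  TensorProduct.lift ((LinearMap.lsmul ℂ V).comp (ψ : W →ₗ[ℂ] ℂ)).flip

theorem rightSliceLin_tmul (φ : StrongDual ℂ V) (v : V) (w : W) :
    rightSliceLin φ (v ⊗ₜ[ℂ] w) = φ v • w := by
  simp [rightSliceLin]

theorem leftSliceLin_tmul (ψ : StrongDual ℂ W) (v : V) (w : W) :
    leftSliceLin ψ (v ⊗ₜ[ℂ] w) = ψ w • v := by
  simp [leftSliceLin]

theorem norm_rightSliceLin_le (jV : OperatorSpaceStructure V H) (jW : OperatorSpaceStructure W K)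
    (φ : StrongDual ℂ V) (u : V ⊗[ℂ] W) :
    ‖rightSliceLin φ u‖ ≤ ‖φ‖ * haagerupNorm jV jW u := by
  refine norm_le_mul_haagerupNorm jV jW u _ _ (norm_nonneg _) fun n v w hu => ?_
  rw [hu, map_sum, ← mul_assoc]
  simp only [rightSliceLin_tmul]
  refine (norm_sum_smul_le_col jW _ w).trans
    (mul_le_mul_of_nonneg_right ?_ (colNorm_nonneg _ _))
  exact sqrt_sum_sq_le φ v _ (rowNorm_nonneg _ _) fun c => norm_sum_smul_le_row jV c v

theorem norm_leftSliceLin_le (jV : OperatorSpaceStructure V H) (jW : OperatorSpaceStructure W K)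
    (ψ : StrongDual ℂ W) (u : V ⊗[ℂ] W) :
    ‖leftSliceLin ψ u‖ ≤ ‖ψ‖ * haagerupNorm jV jW u := by
  refine norm_le_mul_haagerupNorm jV jW u _ _ (norm_nonneg _) fun n v w hu => ?_
  rw [hu, map_sum, mul_comm (rowNorm jV v), ← mul_assoc]
  simp only [leftSliceLin_tmul]
  refine (norm_sum_smul_le_row jV _ v).trans
    (mul_le_mul_of_nonneg_right ?_ (rowNorm_nonneg _ _))
  exact sqrt_sum_sq_le ψ w _ (colNorm_nonneg _ _) fun c => norm_sum_smul_le_col jW c w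

variable (jV : OperatorSpaceStructure V H) (jW : OperatorSpaceStructure W K)

/-- `rightSliceLin φ` as a bounded map for the Haagerup norm. -/
def rightSliceAlg (φ : StrongDual ℂ V) : AlgTensor jV jW →L[ℂ] W :=
  ((rightSliceLin φ).comp (AlgTensor.equiv jV jW).toLinearMap).mkContinuous ‖φ‖
    fun u => by
      rw [norm_algTensor, LinearMap.comp_apply]
      exact norm_rightSliceLin_le jV jW φ (AlgTensor.equiv jV jW u)

/-- `leftSliceLin ψ` as a bounded map for the Haagerup norm. -/
def leftSliceAlg (ψ : StrongDual ℂ W) : AlgTensor jV jW →L[ℂ] V :=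
  ((leftSliceLin ψ).comp (AlgTensor.equiv jV jW).toLinearMap).mkContinuous ‖ψ‖
    fun u => by
      rw [norm_algTensor, LinearMap.comp_apply]
      exact norm_leftSliceLin_le jV jW ψ (AlgTensor.equiv jV jW u)

/-- The slice map `R_φ : V ⊗_h W → W`, the continuous extension of `v ⊗ w ↦ φ(v) w`. -/
def rightSlice [CompleteSpace W] (φ : StrongDual ℂ V) : HaagerupTensor jV jW →L[ℂ] W :=
  (rightSliceAlg jV jW φ).extend
    (UniformSpace.Completion.toComplL : AlgTensor jV jW →L[ℂ] HaagerupTensor jV jW)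

/-- The slice map `L_ψ : V ⊗_h W → V`, the continuous extension of `v ⊗ w ↦ ψ(w) v`. -/
def leftSlice [CompleteSpace V] (ψ : StrongDual ℂ W) : HaagerupTensor jV jW →L[ℂ] V :=
  (leftSliceAlg jV jW ψ).extend
    (UniformSpace.Completion.toComplL : AlgTensor jV jW →L[ℂ] HaagerupTensor jV jW)

theorem rightSlice_tmul [CompleteSpace W] (φ : StrongDual ℂ V) (v : V) (w : W) :
    rightSlice jV jW φ (tmul jV jW v w) = φ v • w := by
  have h := ContinuousLinearMap.extend_eq (rightSliceAlg jV jW φ)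
    (e := (UniformSpace.Completion.toComplL : AlgTensor jV jW →L[ℂ] HaagerupTensor jV jW))
    UniformSpace.Completion.denseRange_coe
    (UniformSpace.Completion.isUniformInducing_coe _)
    ((AlgTensor.equiv jV jW).symm (v ⊗ₜ[ℂ] w))
  exact h.trans (rightSliceLin_tmul φ v w)

theorem leftSlice_tmul [CompleteSpace V] (ψ : StrongDual ℂ W) (v : V) (w : W) :
    leftSlice jV jW ψ (tmul jV jW v w) = ψ w • v := by
  have h := ContinuousLinearMap.extend_eq (leftSliceAlg jV jW ψ)
    (e := (UniformSpace.Completion.toComplL : AlgTensor jV jW →L[ℂ] HaagerupTensor jV jW))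
    UniformSpace.Completion.denseRange_coe
    (UniformSpace.Completion.isUniformInducing_coe _)
    ((AlgTensor.equiv jV jW).symm (v ⊗ₜ[ℂ] w))
  exact h.trans (leftSliceLin_tmul ψ v w)

end Norms

section BanachStarAlgebra

universe u

variable {A : Type u} [NonUnitalNormedRing A] [StarRing A] [NormedSpace ℂ A]

/-- A continuous linear form `f` is positive if `f (x* x) ≥ 0` for every `x`. -/
def IsPositiveForm (f : StrongDual ℂ A) : Prop :=
  ∀ x : A, 0 ≤ (f (star x * x)).re ∧ (f (star x * x)).im = 0

/-- A pure state: a continuous positive form of norm one such that every continuous positive form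
dominated by it is a multiple of it. -/
structure IsPureState (f : StrongDual ℂ A) : Prop where
  positive : IsPositiveForm f
  norm_eq_one : ‖f‖ = 1
  pure : ∀ g : StrongDual ℂ A, IsPositiveForm g → IsPositiveForm (f - g) →
    ∃ t : ℝ, 0 ≤ t ∧ t ≤ 1 ∧ g = (t : ℂ) • f

variable (A) in
/-- `A` is reduced: for every `a ≠ 0` there is a `*`-representation `π` of `A` on a Hilbert space
with `π a ≠ 0`.  (A Hilbert space in the universe of `A` suffices, since the closed cyclic
subspaces of any representation are completions of quotients of `A`.) -/
def IsStarReduced : Prop :=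
  ∀ a : A, a ≠ 0 → ∃ (H : Type u) (_ : NormedAddCommGroup H) (_ : InnerProductSpace ℂ H)
    (_ : CompleteSpace H) (π : A →⋆ₙₐ[ℂ] (H →L[ℂ] H)), π a ≠ 0

variable (A) in
/-- `A` has a (two-sided, not necessarily bounded) approximate identity. -/
def HasApproximateIdentity : Prop :=
  ∃ l : Filter A, l.IsApproximateUnit

end BanachStarAlgebra

end Haagerup

end

/-!
Let `S` be a set of functionals separating the points of `V`.  All three assertions follow from two
facts: the slice maps `R_φ`, `φ ∈ S`, separate the points of `V ⊗_h W` (`rightSlice_separates`, with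
the mirror statement `leftSlice_separates`), and the pure states of a reduced Banach `*`-algebra
with approximate identity separate its points (`pureStates_separate`).

*Slice maps.*  An element `y` of `V ⊗_h W` is a series `∑ vᵢ ⊗ wᵢ` whose row `(vᵢ)` and column
`(wᵢ)` have small tails (`exists_rowColumnSeries`).  Let `M ⊆ ℓ²` be the closed span of the
sequences conjugate to `(φ(vᵢ))`, `φ ∈ S`, and let `P` be the projection onto `M`.  Sequences
orthogonal to `M` annihilate the row `v`, because `S` separates points; if all `R_φ y` vanish,
the conjugates of sequences in `M` annihilate the column `w`.  Inserting `1 = P + (1 - P)` between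
the row and the column therefore gives `y = v ⊙ P w + v (1 - P) ⊙ w = 0`.  On finite truncations the
two terms equal, up to sign, terms involving only tails, and they are small because a contractive
scalar matrix does not increase row and column norms
(`tendsto_haagerupNorm_zero_of_orthogonal`).

*Pure states.*  The quasi-states, that is the positive forms with `|f x|² ≤ f (x* x)`, form a
weak-* compact convex set.  It contains the vector forms of `*`-representations, so on a reduced
algebra it separates points, and by the Krein–Milman theorem its extreme points do.  It remains to
see that a nonzero extreme quasi-state `f` is a multiple of a pure state (`isPureState_of_extreme`).
As the approximate identity may be unbounded, norms of positive forms need not be additive.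
Instead, for `0 ≤ g ≤ f`, one takes `yₙ ∈ A` converging to the cyclic vector in the GNS space of
`f`; then `g (yₙ* x) → g x`, and the Cauchy–Schwarz inequality gives `|g x|² ≤ C g (x* x)` and
`|(f - g) x|² ≤ (1 - C) (f - g) (x* x)` with `C = lim g (yₙ* yₙ)` (`IsQuasiState.exists_split`).
This writes `f` as a convex combination of the quasi-states `g / C` and `(f - g) / (1 - C)`, so
`g = C f`.
-/

noncomputable section

namespace Haagerup
open Filter Topology

section SliceSeparation

variable {V W H K ι : Type*}
  [NormedAddCommGroup V] [NormedSpace ℂ V] [NormedAddCommGroup W] [NormedSpace ℂ W]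
  [NormedAddCommGroup H] [InnerProductSpace ℂ H] [CompleteSpace H]
  [NormedAddCommGroup K] [InnerProductSpace ℂ K] [CompleteSpace K]

/-! ### Rows and columns over finite index sets -/

/-- The norm of the row `(vᵢ)` over a finite index set `F`. -/
def rowNormOn (jV : OperatorSpaceStructure V H) (F : Finset ι) (v : ι → V) : ℝ :=
  Real.sqrt ‖∑ i ∈ F, jV (v i) * star (jV (v i))‖

/-- The norm of the column `(wᵢ)` over a finite index set `F`. -/
def colNormOn (jW : OperatorSpaceStructure W K) (F : Finset ι) (w : ι → W) : ℝ :=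
  Real.sqrt ‖∑ i ∈ F, star (jW (w i)) * jW (w i)‖

theorem rowNormOn_nonneg (jV : OperatorSpaceStructure V H) (F : Finset ι) (v : ι → V) :
    0 ≤ rowNormOn jV F v := Real.sqrt_nonneg _

theorem colNormOn_nonneg (jW : OperatorSpaceStructure W K) (F : Finset ι) (w : ι → W) :
    0 ≤ colNormOn jW F w := Real.sqrt_nonneg _

theorem sum_equivFin {X : Type*} [AddCommMonoid X] (F : Finset ι) (f : ι → X) :
    ∑ k, f (F.equivFin.symm k) = ∑ i ∈ F, f i := by
  rw [← Finset.sum_coe_sort F f]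
  exact Equiv.sum_comp F.equivFin.symm (fun i : F => f i)

theorem rowNorm_equivFin (jV : OperatorSpaceStructure V H) (F : Finset ι) (v : ι → V) :
    rowNorm jV (fun k => v (F.equivFin.symm k)) = rowNormOn jV F v := by
  rw [rowNorm, rowNormOn, sum_equivFin F fun i => jV (v i) * star (jV (v i))]

theorem colNorm_equivFin (jW : OperatorSpaceStructure W K) (F : Finset ι) (w : ι → W) :
    colNorm jW (fun k => w (F.equivFin.symm k)) = colNormOn jW F w := by
  rw [colNorm, colNormOn, sum_equivFin F fun i => star (jW (w i)) * jW (w i)]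

theorem haagerupNorm_sum_le (jV : OperatorSpaceStructure V H) (jW : OperatorSpaceStructure W K)
    (F : Finset ι) (v : ι → V) (w : ι → W) :
    haagerupNorm jV jW (∑ i ∈ F, v i ⊗ₜ[ℂ] w i) ≤ rowNormOn jV F v * colNormOn jW F w := by
  rw [← rowNorm_equivFin, ← colNorm_equivFin, ← sum_equivFin F fun i => v i ⊗ₜ[ℂ] w i]
  exact haagerupNorm_le _ _ _ _

theorem norm_sum_smul_le_colOn (jW : OperatorSpaceStructure W K) (F : Finset ι) (c : ι → ℂ)
    (w : ι → W) : ‖∑ i ∈ F, c i • w i‖ ≤ Real.sqrt (∑ i ∈ F, ‖c i‖ ^ 2) * colNormOn jW F w := by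
  rw [← colNorm_equivFin, ← sum_equivFin F fun i => c i • w i,
    ← sum_equivFin F fun i => ‖c i‖ ^ 2]
  exact norm_sum_smul_le_col jW _ _

theorem norm_sum_smul_le_rowOn (jV : OperatorSpaceStructure V H) (F : Finset ι) (c : ι → ℂ)
    (v : ι → V) : ‖∑ i ∈ F, c i • v i‖ ≤ Real.sqrt (∑ i ∈ F, ‖c i‖ ^ 2) * rowNormOn jV F v := by
  rw [← rowNorm_equivFin, ← sum_equivFin F fun i => c i • v i,
    ← sum_equivFin F fun i => ‖c i‖ ^ 2]
  exact norm_sum_smul_le_row jV _ _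

theorem haagerupNorm_tmul_le (jV : OperatorSpaceStructure V H) (jW : OperatorSpaceStructure W K)
    (v : V) (w : W) : haagerupNorm jV jW (v ⊗ₜ[ℂ] w) ≤ ‖v‖ * ‖w‖ := by
  have h := haagerupNorm_le jV jW (n := 1) (fun _ => v) (fun _ => w)
  simpa [rowNorm, colNorm, CStarRing.norm_self_mul_star, CStarRing.norm_star_mul_self,
    Real.sqrt_mul_self] using h

/-! ### Scalar contractions acting on columns and rows -/

theorem sum_norm_sq_apply_le (jW : OperatorSpaceStructure W K) (F : Finset ι) (w : ι → W) (x : K) :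
    ∑ i ∈ F, ‖jW (w i) x‖ ^ 2 ≤ (colNormOn jW F w * ‖x‖) ^ 2 := by
  have e : ((∑ i ∈ F, ‖jW (w i) x‖ ^ 2 : ℝ) : ℂ)
      = inner ℂ ((∑ i ∈ F, star (jW (w i)) * jW (w i)) x) x := by
    simp only [sum_apply, sum_inner, mul_apply_eq_comp,
      ContinuousLinearMap.star_eq_adjoint, ContinuousLinearMap.adjoint_inner_left,
      inner_self_eq_norm_sq_to_K]
    push_cast
    rfl
  have h4 : ‖((∑ i ∈ F, ‖jW (w i) x‖ ^ 2 : ℝ) : ℂ)‖ = ∑ i ∈ F, ‖jW (w i) x‖ ^ 2 := by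
    rw [Complex.norm_real, Real.norm_of_nonneg (Finset.sum_nonneg fun i _ => sq_nonneg _)]
  rw [← h4, e, mul_pow, colNormOn, Real.sq_sqrt (norm_nonneg _), sq, ← mul_assoc]
  refine (norm_inner_le_norm _ _).trans ?_
  exact mul_le_mul_of_nonneg_right (ContinuousLinearMap.le_opNorm _ _) (norm_nonneg _)

theorem colNormOn_le (jW : OperatorSpaceStructure W K) (F : Finset ι) (w : ι → W) (C : ℝ)
    (hC : 0 ≤ C) (h : ∀ x : K, ∑ i ∈ F, ‖jW (w i) x‖ ^ 2 ≤ (C * ‖x‖) ^ 2) :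
    colNormOn jW F w ≤ C := by
  rw [colNormOn, Real.sqrt_le_left hC]
  refine ContinuousLinearMap.opNorm_le_bound _ (sq_nonneg C) fun x => ?_
  set T : K →L[ℂ] K := ∑ i ∈ F, star (jW (w i)) * jW (w i) with hT
  -- `‖T x‖² = ∑ ⟪wᵢ (T x), wᵢ x⟫`, and Cauchy–Schwarz in `ℓ²(F, K)` applies
  have e : ((‖T x‖ ^ 2 : ℝ) : ℂ) = ∑ i ∈ F, inner ℂ (jW (w i) (T x)) (jW (w i) x) := by
    have : ((‖T x‖ ^ 2 : ℝ) : ℂ) = inner ℂ (T x) (T x) := by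
      rw [inner_self_eq_norm_sq_to_K]; push_cast; rfl
    rw [this]
    conv_lhs => rw [hT]
    simp only [sum_apply, inner_sum, mul_apply_eq_comp, ContinuousLinearMap.star_eq_adjoint,
      ContinuousLinearMap.adjoint_inner_right]
    rw [hT]
    simp only [sum_apply, mul_apply_eq_comp, ContinuousLinearMap.star_eq_adjoint]
  have h1 : ‖T x‖ ^ 2 ≤ ∑ i ∈ F, ‖jW (w i) (T x)‖ * ‖jW (w i) x‖ := by
    have h2 : ‖((‖T x‖ ^ 2 : ℝ) : ℂ)‖ = ‖T x‖ ^ 2 := by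
      rw [Complex.norm_real, Real.norm_of_nonneg (sq_nonneg _)]
    rw [← h2, e]
    exact (norm_sum_le _ _).trans (Finset.sum_le_sum fun i _ => norm_inner_le_norm _ _)
  have h2 : ‖T x‖ ^ 2 ≤ (C * ‖T x‖) * (C * ‖x‖) := by
    refine (h1.trans (Real.sum_mul_le_sqrt_mul_sqrt _ _ _)).trans ?_
    exact mul_le_mul (Real.sqrt_le_left (by positivity) |>.mpr (h _))
      (Real.sqrt_le_left (by positivity) |>.mpr (h _)) (Real.sqrt_nonneg _) (by positivity)
  rcases (norm_nonneg (T x)).eq_or_lt with h0 | hpos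
  · rw [← h0]; positivity
  · refine le_of_mul_le_mul_left ?_ hpos
    nlinarith [h2]

/-- A scalar matrix that is contractive on `ℓ²` stays contractive on `ℓ² ⊗ K`. -/
theorem sum_norm_sq_matrix_le {ι κ K : Type*} [NormedAddCommGroup K] [InnerProductSpace ℂ K]
    (F : Finset ι) (G : Finset κ) (p : ι → κ → ℂ)
    (hp : ∀ μ : κ → ℂ, ∑ i ∈ F, ‖∑ j ∈ G, p i j * μ j‖ ^ 2 ≤ ∑ j ∈ G, ‖μ j‖ ^ 2)
    (k : κ → K) :
    ∑ i ∈ F, ‖∑ j ∈ G, p i j • k j‖ ^ 2 ≤ ∑ j ∈ G, ‖k j‖ ^ 2 := by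
  classical
  -- expand everything in an orthonormal basis of the span of the vectors `k j`
  set U : Submodule ℂ K := Submodule.span ℂ (G.image k : Set K) with hU
  have hkU : ∀ j ∈ G, k j ∈ U := fun j hj =>
    Submodule.subset_span (by simpa using ⟨j, hj, rfl⟩)
  let b := stdOrthonormalBasis ℂ U
  have hb : ∀ z ∈ U, ‖z‖ ^ 2 = ∑ a, ‖inner ℂ (b a : K) z‖ ^ 2 := by
    intro z hz
    have := b.sum_sq_norm_inner_right ⟨z, hz⟩
    simpa using this.symm
  have h1 : ∀ i ∈ F, ‖∑ j ∈ G, p i j • k j‖ ^ 2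
      = ∑ a, ‖∑ j ∈ G, p i j * inner ℂ (b a : K) (k j)‖ ^ 2 := by
    intro i _
    rw [hb _ (Submodule.sum_mem _ fun j hj => Submodule.smul_mem _ _ (hkU j hj))]
    simp only [inner_sum, inner_smul_right]
  rw [Finset.sum_congr rfl h1, Finset.sum_comm, Finset.sum_congr rfl fun j hj => hb _ (hkU j hj),
    Finset.sum_comm (s := G)]
  exact Finset.sum_le_sum fun a _ => hp _

theorem colNormOn_matrix_le {κ : Type*} (jW : OperatorSpaceStructure W K) (F : Finset ι)
    (G : Finset κ) (p : ι → κ → ℂ)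
    (hp : ∀ μ : κ → ℂ, ∑ i ∈ F, ‖∑ j ∈ G, p i j * μ j‖ ^ 2 ≤ ∑ j ∈ G, ‖μ j‖ ^ 2)
    (w : κ → W) :
    colNormOn jW F (fun i => ∑ j ∈ G, p i j • w j) ≤ colNormOn jW G w := by
  refine colNormOn_le jW F _ _ (colNormOn_nonneg _ _ _) fun x => ?_
  simp only [map_sum, map_smul, sum_apply, smul_apply]
  exact (sum_norm_sq_matrix_le F G p hp _).trans (sum_norm_sq_apply_le jW G w x)

theorem rowNormOn_eq_colNormOn_star (jV : OperatorSpaceStructure V H) (F : Finset ι) (v : ι → V) :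
    rowNormOn jV F v = colNormOn (LinearIsometry.id : (H →L[ℂ] H) →ₗᵢ[ℂ] (H →L[ℂ] H)) F
      (fun i => star (jV (v i))) := by
  simp [rowNormOn, colNormOn]

theorem contractive_matrix_star {κ : Type*} {F : Finset ι} {G : Finset κ} {p : ι → κ → ℂ}
    (hp : ∀ μ : κ → ℂ, ∑ i ∈ F, ‖∑ j ∈ G, p i j * μ j‖ ^ 2 ≤ ∑ j ∈ G, ‖μ j‖ ^ 2) (μ : κ → ℂ) :
    ∑ i ∈ F, ‖∑ j ∈ G, star (p i j) * μ j‖ ^ 2 ≤ ∑ j ∈ G, ‖μ j‖ ^ 2 := by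
  have e : ∀ i, ‖∑ j ∈ G, star (p i j) * μ j‖ = ‖∑ j ∈ G, p i j * star (μ j)‖ := by
    intro i
    rw [← norm_star, star_sum]
    simp [mul_comm]
  simp only [e]
  simpa only [norm_star] using hp fun j => star (μ j)

theorem rowNormOn_matrix_le {κ : Type*} (jV : OperatorSpaceStructure V H) (F : Finset ι)
    (G : Finset κ) (p : ι → κ → ℂ)
    (hp : ∀ μ : κ → ℂ, ∑ i ∈ F, ‖∑ j ∈ G, p i j * μ j‖ ^ 2 ≤ ∑ j ∈ G, ‖μ j‖ ^ 2)
    (v : κ → V) :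
    rowNormOn jV F (fun i => ∑ j ∈ G, p i j • v j) ≤ rowNormOn jV G v := by
  rw [rowNormOn_eq_colNormOn_star, rowNormOn_eq_colNormOn_star]
  have h := colNormOn_matrix_le (LinearIsometry.id : (H →L[ℂ] H) →ₗᵢ[ℂ] (H →L[ℂ] H)) F G
    (fun i j => star (p i j)) (contractive_matrix_star hp) (fun j => star (jV (v j)))
  simpa [map_sum, star_sum, star_smul] using h

/-- Matrix coefficients of a contraction with respect to an orthonormal family form a contractive
matrix, by Bessel's inequality. -/
theorem contractive_matrix_of_orthonormal {E : Type*} [NormedAddCommGroup E]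
    [InnerProductSpace ℂ E] {e : ι → E} (he : Orthonormal ℂ e) (T : E →L[ℂ] E)
    (hT : ∀ x, ‖T x‖ ≤ ‖x‖) (F G : Finset ι) (μ : ι → ℂ) :
    ∑ i ∈ F, ‖∑ j ∈ G, inner ℂ (e i) (T (e j)) * μ j‖ ^ 2 ≤ ∑ j ∈ G, ‖μ j‖ ^ 2 := by
  have h1 : ∀ i, ∑ j ∈ G, inner ℂ (e i) (T (e j)) * μ j
      = inner ℂ (e i) (T (∑ j ∈ G, μ j • e j)) := by
    intro i
    simp only [map_sum, map_smul, inner_sum, inner_smul_right, mul_comm]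
  simp only [h1]
  refine (he.sum_inner_products_le _).trans ?_
  refine (pow_le_pow_left₀ (norm_nonneg _) (hT _) 2).trans (le_of_eq ?_)
  have h2 : ((‖∑ j ∈ G, μ j • e j‖ ^ 2 : ℝ) : ℂ) = ((∑ j ∈ G, ‖μ j‖ ^ 2 : ℝ) : ℂ) := by
    have := he.inner_sum μ μ G
    rw [inner_self_eq_norm_sq_to_K] at this
    push_cast
    refine this.trans (Finset.sum_congr rfl fun i _ => Complex.conj_mul' _)
  exact_mod_cast h2

/-! ### Splitting `ℓ²` between the row and the column -/

theorem haagerupNorm_sub_le (jV : OperatorSpaceStructure V H) (jW : OperatorSpaceStructure W K)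
    (x y : V ⊗[ℂ] W) :
    haagerupNorm jV jW (x - y) ≤ haagerupNorm jV jW x + haagerupNorm jV jW y := by
  have h := haagerupNorm_smul_le jV jW (-1) y
  rw [neg_one_smul, norm_neg, norm_one, one_mul] at h
  rw [sub_eq_add_neg]
  exact (haagerupNorm_add_le jV jW x (-y)).trans (by linarith)

theorem haagerupNorm_finset_sum_le (jV : OperatorSpaceStructure V H)
    (jW : OperatorSpaceStructure W K) (F : Finset ι) (f : ι → V ⊗[ℂ] W) :
    haagerupNorm jV jW (∑ i ∈ F, f i) ≤ ∑ i ∈ F, haagerupNorm jV jW (f i) :=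
  Finset.le_sum_of_subadditive _ (haagerupNorm_zero jV jW).le (haagerupNorm_add_le jV jW) _ _

/-- If every row of the contractive matrix `p` annihilates the column `w`, then a truncation of
`∑ vᵢ ⊗ pᵢⱼ wⱼ` equals minus the part involving only the tail of `w`, hence is small. -/
theorem haagerupNorm_row_matrix_col_le (jV : OperatorSpaceStructure V H)
    (jW : OperatorSpaceStructure W K) [DecidableEq ι] {F : ℕ → Finset ι} (hF : Monotone F)
    (v : ι → V) (w : ι → W) (p : ι → ι → ℂ) {a b : ℝ} (N : ℕ)
    (hv : rowNormOn jV (F N) v ≤ a) (hw : ∀ M, N ≤ M → colNormOn jW (F M \ F N) w ≤ b)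
    (hp : ∀ (G : Finset ι) (μ : ι → ℂ),
      ∑ i ∈ F N, ‖∑ j ∈ G, p i j * μ j‖ ^ 2 ≤ ∑ j ∈ G, ‖μ j‖ ^ 2)
    (h0 : ∀ i, Tendsto (fun M => ∑ j ∈ F M, p i j • w j) atTop (𝓝 0)) :
    haagerupNorm jV jW (∑ i ∈ F N, v i ⊗ₜ[ℂ] ∑ j ∈ F N, p i j • w j) ≤ a * b := by
  have hlim : Tendsto (fun M => ∑ i ∈ F N, ‖v i‖ * ‖∑ j ∈ F M, p i j • w j‖ + a * b) atTop
      (𝓝 (∑ i ∈ F N, ‖v i‖ * ‖(0 : W)‖ + a * b)) :=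
    (tendsto_finsetSum _ fun i _ => ((h0 i).norm.const_mul _)).add_const _
  simp only [norm_zero, mul_zero, Finset.sum_const_zero, zero_add] at hlim
  refine ge_of_tendsto hlim ?_
  filter_upwards [eventually_ge_atTop N] with M hM
  have e : ∑ i ∈ F N, v i ⊗ₜ[ℂ] ∑ j ∈ F N, p i j • w j
      = ∑ i ∈ F N, v i ⊗ₜ[ℂ] ∑ j ∈ F M, p i j • w j
        - ∑ i ∈ F N, v i ⊗ₜ[ℂ] ∑ j ∈ F M \ F N, p i j • w j := by
    rw [← Finset.sum_sub_distrib]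
    refine Finset.sum_congr rfl fun i _ => ?_
    rw [← TensorProduct.tmul_sub, ← Finset.sum_sdiff (hF hM), add_sub_cancel_left]
  rw [e]
  refine (haagerupNorm_sub_le _ _ _ _).trans (add_le_add ?_ ?_)
  · exact (haagerupNorm_finset_sum_le _ _ _ _).trans
      (Finset.sum_le_sum fun i _ => haagerupNorm_tmul_le _ _ _ _)
  · refine (haagerupNorm_sum_le _ _ _ _ _).trans ?_
    exact mul_le_mul hv ((colNormOn_matrix_le jW _ _ p (hp _) w).trans (hw M hM))
      (colNormOn_nonneg _ _ _) ((rowNormOn_nonneg _ _ _).trans hv)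

/-- The mirror image of `haagerupNorm_row_matrix_col_le`, where the row `v` is annihilated. -/
theorem haagerupNorm_row_matrix_col_le' (jV : OperatorSpaceStructure V H)
    (jW : OperatorSpaceStructure W K) [DecidableEq ι] {F : ℕ → Finset ι} (hF : Monotone F)
    (v : ι → V) (w : ι → W) (p : ι → ι → ℂ) {a b : ℝ} (N : ℕ)
    (hv : ∀ M, N ≤ M → rowNormOn jV (F M \ F N) v ≤ a) (hw : colNormOn jW (F N) w ≤ b)
    (hp : ∀ (G : Finset ι) (μ : ι → ℂ),
      ∑ j ∈ F N, ‖∑ i ∈ G, p j i * μ i‖ ^ 2 ≤ ∑ i ∈ G, ‖μ i‖ ^ 2)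
    (h0 : ∀ j, Tendsto (fun M => ∑ i ∈ F M, p j i • v i) atTop (𝓝 0)) :
    haagerupNorm jV jW (∑ j ∈ F N, (∑ i ∈ F N, p j i • v i) ⊗ₜ[ℂ] w j) ≤ a * b := by
  have hlim : Tendsto (fun M => ∑ j ∈ F N, ‖∑ i ∈ F M, p j i • v i‖ * ‖w j‖ + a * b) atTop
      (𝓝 (∑ j ∈ F N, ‖(0 : V)‖ * ‖w j‖ + a * b)) :=
    (tendsto_finsetSum _ fun i _ => ((h0 i).norm.mul_const _)).add_const _
  simp only [norm_zero, zero_mul, Finset.sum_const_zero, zero_add] at hlim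
  refine ge_of_tendsto hlim ?_
  filter_upwards [eventually_ge_atTop N] with M hM
  have e : ∑ j ∈ F N, (∑ i ∈ F N, p j i • v i) ⊗ₜ[ℂ] w j
      = ∑ j ∈ F N, (∑ i ∈ F M, p j i • v i) ⊗ₜ[ℂ] w j
        - ∑ j ∈ F N, (∑ i ∈ F M \ F N, p j i • v i) ⊗ₜ[ℂ] w j := by
    rw [← Finset.sum_sub_distrib]
    refine Finset.sum_congr rfl fun i _ => ?_
    rw [← TensorProduct.sub_tmul, ← Finset.sum_sdiff (hF hM), add_sub_cancel_left]
  rw [e]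
  refine (haagerupNorm_sub_le _ _ _ _).trans (add_le_add ?_ ?_)
  · exact (haagerupNorm_finset_sum_le _ _ _ _).trans
      (Finset.sum_le_sum fun i _ => haagerupNorm_tmul_le _ _ _ _)
  · refine (haagerupNorm_sum_le _ _ _ _ _).trans ?_
    have h := (rowNormOn_matrix_le jV _ _ p (hp _) v).trans (hv M hM)
    exact mul_le_mul h hw (colNormOn_nonneg _ _ _) ((rowNormOn_nonneg _ _ _).trans h)

/-- The splitting argument: `ℓ²(ι) = M ⊕ Mᗮ`, where the (conjugated) sequences in `M` annihilate
the column `w` and those in `Mᗮ` annihilate the row `v`.  Inserting `1 = P + (1 - P)` between the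
row and the column shows that `∑ vᵢ ⊗ wᵢ` is zero in the limit. -/
theorem tendsto_haagerupNorm_zero_of_orthogonal (jV : OperatorSpaceStructure V H)
    (jW : OperatorSpaceStructure W K) [DecidableEq ι] {F : ℕ → Finset ι} (hF : Monotone F)
    (hF0 : F 0 = ∅) (v : ι → V) (w : ι → W) {τ : ℕ → ℝ} (hτ : Tendsto τ atTop (𝓝 0))
    (hv : ∀ N M, N ≤ M → rowNormOn jV (F M \ F N) v ≤ τ N)
    (hw : ∀ N M, N ≤ M → colNormOn jW (F M \ F N) w ≤ τ N)
    (M : Submodule ℂ (lp (fun _ : ι => ℂ) 2)) [M.HasOrthogonalProjection]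
    (hM : ∀ c ∈ M, Tendsto (fun N => ∑ j ∈ F N, star (c j) • w j) atTop (𝓝 0))
    (hM' : ∀ c ∈ Mᗮ, Tendsto (fun N => ∑ i ∈ F N, c i • v i) atTop (𝓝 0)) :
    Tendsto (fun N => haagerupNorm jV jW (∑ i ∈ F N, v i ⊗ₜ[ℂ] w i)) atTop (𝓝 0) := by
  -- the unit vectors `e i`, and the matrices of `P` and `Q = 1 - P` with respect to them
  set e : ι → lp (fun _ : ι => ℂ) 2 := fun i => lp.single 2 i (1 : ℂ) with he_def
  have he_inner : ∀ i (f : lp (fun _ : ι => ℂ) 2), inner ℂ (e i) f = f i := by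
    intro i f
    rw [he_def, lp.inner_single_left]
    simp
  have he : Orthonormal ℂ e := by
    rw [orthonormal_iff_ite]
    intro i j
    rw [he_inner, he_def, lp.single_apply, Pi.single_apply]
  set P := M.starProjection with hP
  set Q := Mᗮ.starProjection with hQ
  have hPQ : ∀ x, P x + Q x = x := fun x => M.starProjection_add_starProjection_orthogonal x
  have hPs : ∀ x y, inner ℂ (P x) y = inner ℂ x (P y) := fun x y =>
    M.inner_starProjection_left_eq_right x y
  have hQs : ∀ x y, inner ℂ (Q x) y = inner ℂ x (Q y) := fun x y =>
    Mᗮ.inner_starProjection_left_eq_right x y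
  have hPn : ∀ x, ‖P x‖ ≤ ‖x‖ := fun x => M.norm_starProjection_apply_le x
  have hQn : ∀ x, ‖Q x‖ ≤ ‖x‖ := fun x => Mᗮ.norm_starProjection_apply_le x
  have hτ0 : ∀ N, rowNormOn jV (F N) v ≤ τ 0 := fun N => by simpa [hF0] using hv 0 N N.zero_le
  have hτ0' : ∀ N, colNormOn jW (F N) w ≤ τ 0 := fun N => by simpa [hF0] using hw 0 N N.zero_le
  have hA : ∀ N, haagerupNorm jV jW
      (∑ i ∈ F N, v i ⊗ₜ[ℂ] ∑ j ∈ F N, inner ℂ (e i) (P (e j)) • w j) ≤ τ 0 * τ N := fun N => by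
    refine haagerupNorm_row_matrix_col_le jV jW hF v w _ N (hτ0 N) (hw N)
      (fun G μ => contractive_matrix_of_orthonormal he P hPn _ _ _) fun i => ?_
    refine (hM (P (e i)) (M.starProjection_apply_mem _)).congr fun N => ?_
    refine Finset.sum_congr rfl fun j _ => ?_
    rw [← he_inner, ← hPs, ← inner_conj_symm]
    simp
  have hB : ∀ N, haagerupNorm jV jW
      (∑ j ∈ F N, (∑ i ∈ F N, inner ℂ (e i) (Q (e j)) • v i) ⊗ₜ[ℂ] w j) ≤ τ N * τ 0 := fun N => by
    refine haagerupNorm_row_matrix_col_le' jV jW hF v w (fun j i => inner ℂ (e i) (Q (e j))) N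
      (hv N) (hτ0' N) (fun G μ => ?_) fun j => ?_
    · have h := contractive_matrix_star
        (contractive_matrix_of_orthonormal he Q hQn (F N) G) μ
      have e1 : ∀ i j, star (inner ℂ (e j) (Q (e i))) = inner ℂ (e i) (Q (e j)) := fun i j => by
        rw [← hQs]; exact inner_conj_symm _ _
      simpa only [e1] using h
    · refine (hM' (Q (e j)) (Mᗮ.starProjection_apply_mem _)).congr fun N => ?_
      exact Finset.sum_congr rfl fun i _ => by rw [he_inner]
  have hsum : ∀ N, ∑ i ∈ F N, v i ⊗ₜ[ℂ] w i
      = (∑ i ∈ F N, v i ⊗ₜ[ℂ] ∑ j ∈ F N, inner ℂ (e i) (P (e j)) • w j)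
        + ∑ j ∈ F N, (∑ i ∈ F N, inner ℂ (e i) (Q (e j)) • v i) ⊗ₜ[ℂ] w j := by
    intro N
    simp only [TensorProduct.tmul_sum, TensorProduct.sum_tmul, TensorProduct.tmul_smul,
      ← TensorProduct.smul_tmul']
    conv_rhs => rw [Finset.sum_comm, ← Finset.sum_add_distrib]
    refine Finset.sum_congr rfl fun j hj => ?_
    rw [← Finset.sum_add_distrib]
    have e2 : ∀ i, inner ℂ (e i) (P (e j)) • v i ⊗ₜ[ℂ] w j
        + inner ℂ (e i) (Q (e j)) • v i ⊗ₜ[ℂ] w j = if i = j then v i ⊗ₜ[ℂ] w j else 0 := by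
      intro i
      rw [← add_smul, ← inner_add_right, hPQ, orthonormal_iff_ite.mp he]
      simp
    simp only [e2, Finset.sum_ite_eq', hj, if_true]
  have hlim : Tendsto (fun N => τ 0 * τ N + τ N * τ 0) atTop (𝓝 0) := by
    simpa using (hτ.const_mul (τ 0)).add (hτ.mul_const (τ 0))
  refine squeeze_zero (fun N => haagerupNorm_nonneg _ _ _) (fun N => ?_) hlim
  rw [hsum N]
  exact (haagerupNorm_add_le _ _ _ _).trans (add_le_add (hA N) (hB N))

/-- For an equibounded sequence of seminorms, tending pointwise to zero passes from a set to its
closed linear span. -/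
theorem tendsto_seminorm_of_mem_closure_span {E : Type*} [NormedAddCommGroup E] [NormedSpace ℂ E]
    (p : ℕ → Seminorm ℂ E) (R : ℝ) (hp : ∀ N x, p N x ≤ R * ‖x‖) (s : Set E)
    (hs : ∀ x ∈ s, Tendsto (fun N => p N x) atTop (𝓝 0)) {x : E}
    (hx : x ∈ (Submodule.span ℂ s).topologicalClosure) :
    Tendsto (fun N => p N x) atTop (𝓝 0) := by
  have hspan : ∀ y ∈ Submodule.span ℂ s, Tendsto (fun N => p N y) atTop (𝓝 0) := by
    intro y hy
    induction hy using Submodule.span_induction with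
    | mem y hy => exact hs y hy
    | zero => simp
    | add y z _ _ hy hz =>
      refine squeeze_zero (fun N => apply_nonneg _ _) (fun N => map_add_le_add (p N) y z) ?_
      simpa using hy.add hz
    | smul a y _ hy =>
      simp only [map_smul_eq_mul]
      simpa using hy.const_mul ‖a‖
  rw [Metric.tendsto_atTop]
  intro ε hε
  obtain ⟨y, hy, hxy⟩ := Metric.mem_closure_iff.mp hx (ε / (2 * (|R| + 1))) (by positivity)
  obtain ⟨N₀, hN₀⟩ := Metric.tendsto_atTop.mp (hspan y hy) (ε / 2) (by positivity)
  refine ⟨N₀, fun N hN => ?_⟩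
  have h1 := hN₀ N hN
  rw [Real.dist_0_eq_abs, abs_of_nonneg (apply_nonneg _ _)] at h1 ⊢
  have h2 : p N x ≤ p N y + p N (x - y) := by
    simpa using map_add_le_add (p N) y (x - y)
  rw [dist_eq_norm, lt_div_iff₀ (by positivity)] at hxy
  have h3 := hp N (x - y)
  have h4 : R * ‖x - y‖ ≤ |R| * ‖x - y‖ :=
    mul_le_mul_of_nonneg_right (le_abs_self R) (norm_nonneg _)
  nlinarith [norm_nonneg (x - y)]

/-- In a Banach space, a Cauchy sequence is null once a separating set of functionals says so. -/
theorem tendsto_zero_of_separating {X : Type*} [NormedAddCommGroup X] [NormedSpace ℂ X]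
    [CompleteSpace X] (S : Set (StrongDual ℂ X)) (hS : ∀ x, (∀ φ ∈ S, φ x = 0) → x = 0)
    (x : ℕ → X) (hx : CauchySeq x) (h : ∀ φ ∈ S, Tendsto (fun N => φ (x N)) atTop (𝓝 0)) :
    Tendsto x atTop (𝓝 0) := by
  obtain ⟨z, hz⟩ := cauchySeq_tendsto_of_complete hx
  have : z = 0 := hS z fun φ hφ =>
    tendsto_nhds_unique ((φ.continuous.tendsto z).comp hz) (h φ hφ)
  rwa [this] at hz

theorem sum_norm_sq_le_lp (c : lp (fun _ : ι => ℂ) 2) (F : Finset ι) :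
    Real.sqrt (∑ i ∈ F, ‖c i‖ ^ 2) ≤ ‖c‖ := by
  refine Real.sqrt_le_left (norm_nonneg _) |>.mpr ?_
  simpa using lp.sum_rpow_le_norm_rpow (p := 2) (by norm_num) c F

/-- Coefficient sums `∑ cᵢ xᵢ` along an increasing sequence of finite sets are Cauchy when the
tails of `(xᵢ)` act with small norm on `ℓ²`. -/
theorem cauchySeq_sum_of_tail {X : Type*} [NormedAddCommGroup X] {F : ℕ → Finset ι}
    [DecidableEq ι] (hF : Monotone F) {τ : ℕ → ℝ} (hτ : Tendsto τ atTop (𝓝 0)) (x : ι → X) (C : ℝ)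
    (h : ∀ N M, N ≤ M → ‖∑ i ∈ F M \ F N, x i‖ ≤ C * τ N) :
    CauchySeq fun N => ∑ i ∈ F N, x i := by
  refine cauchySeq_of_le_tendsto_0' (fun N => C * τ N) (fun N M hNM => ?_)
    (by simpa using hτ.const_mul C)
  rw [dist_comm, dist_eq_norm, ← Finset.sum_sdiff (hF hNM), add_sub_cancel_right]
  exact h N M hNM

theorem memℓp_of_sum_le {F : ℕ → Finset ι} (hF : Tendsto F atTop atTop) (c : ι → ℂ) (R : ℝ)
    (h : ∀ N, Real.sqrt (∑ i ∈ F N, ‖c i‖ ^ 2) ≤ R) : Memℓp c 2 := by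
  refine memℓp_gen' (C := R ^ 2) fun s => ?_
  obtain ⟨N, hN⟩ := (hF.eventually (eventually_ge_atTop s)).exists
  have h1 : ∑ i ∈ s, ‖c i‖ ^ 2 ≤ ∑ i ∈ F N, ‖c i‖ ^ 2 :=
    Finset.sum_le_sum_of_subset_of_nonneg hN fun _ _ _ => sq_nonneg _
  have h2 := (Real.sqrt_le_iff.mp (h N)).2
  simpa using h1.trans h2

theorem sqrt_sum_sq_le_rowOn (jV : OperatorSpaceStructure V H) (φ : StrongDual ℂ V) (F : Finset ι)
    (v : ι → V) : Real.sqrt (∑ i ∈ F, ‖φ (v i)‖ ^ 2) ≤ ‖φ‖ * rowNormOn jV F v := by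
  rw [← rowNorm_equivFin, ← sum_equivFin F fun i => ‖φ (v i)‖ ^ 2]
  exact sqrt_sum_sq_le φ _ _ (rowNorm_nonneg _ _) fun c => norm_sum_smul_le_row jV c _

theorem sqrt_sum_sq_le_colOn (jW : OperatorSpaceStructure W K) (ψ : StrongDual ℂ W) (F : Finset ι)
    (w : ι → W) : Real.sqrt (∑ i ∈ F, ‖ψ (w i)‖ ^ 2) ≤ ‖ψ‖ * colNormOn jW F w := by
  rw [← colNorm_equivFin, ← sum_equivFin F fun i => ‖ψ (w i)‖ ^ 2]
  exact sqrt_sum_sq_le ψ _ _ (colNorm_nonneg _ _) fun c => norm_sum_smul_le_col jW c _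

theorem tendsto_inner_lp {F : ℕ → Finset ι} (hF : Tendsto F atTop atTop)
    (b c : lp (fun _ : ι => ℂ) 2) :
    Tendsto (fun N => ∑ i ∈ F N, star (b i) * c i) atTop (𝓝 (inner ℂ b c)) := by
  have h := (lp.hasSum_inner (𝕜 := ℂ) b c).comp hF
  refine h.congr fun N => ?_
  simp [mul_comm]

/-- The seminorm `c ↦ ‖∑_{i ∈ F} cᵢ xᵢ‖` on `ℓ²`. -/
def sumSeminorm {X : Type*} [NormedAddCommGroup X] [NormedSpace ℂ X] (F : Finset ι) (x : ι → X) :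
    Seminorm ℂ (lp (fun _ : ι => ℂ) 2) :=
  Seminorm.of (fun c => ‖∑ i ∈ F, c i • x i‖)
    (fun c d => by
      simp only [lp.coeFn_add, Pi.add_apply, add_smul, Finset.sum_add_distrib]
      exact norm_add_le _ _)
    (fun a c => by
      simp only [lp.coeFn_smul, Pi.smul_apply, smul_eq_mul, mul_smul, ← Finset.smul_sum, norm_smul])

/-- The seminorm `c ↦ ‖∑_{i ∈ F} c̄ᵢ xᵢ‖` on `ℓ²`. -/
def starSumSeminorm {X : Type*} [NormedAddCommGroup X] [NormedSpace ℂ X] (F : Finset ι)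
    (x : ι → X) : Seminorm ℂ (lp (fun _ : ι => ℂ) 2) :=
  Seminorm.of (fun c => ‖∑ i ∈ F, star (c i) • x i‖)
    (fun c d => by
      simp only [lp.coeFn_add, Pi.add_apply, star_add, add_smul, Finset.sum_add_distrib]
      exact norm_add_le _ _)
    (fun a c => by
      simp only [lp.coeFn_smul, Pi.smul_apply, smul_eq_mul, star_mul', mul_smul,
        ← Finset.smul_sum, norm_smul, norm_star])

/-! ### Series of elementary tensors -/

/-- The series `∑ vᵢ ⊗ wᵢ` has a small-tailed row and column: along the exhausting increasing
sequence `F N` of finite index sets, starting at `∅`, the tails of both have norm at most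
`τ N → 0`. -/
structure RowColumnSeries (jV : OperatorSpaceStructure V H) (jW : OperatorSpaceStructure W K)
    [DecidableEq ι] (F : ℕ → Finset ι) (v : ι → V) (w : ι → W) (τ : ℕ → ℝ) : Prop where
  mono : Monotone F
  zero : F 0 = ∅
  exhaust : Tendsto F atTop atTop
  tendsto : Tendsto τ atTop (𝓝 0)
  row_tail : ∀ N M, N ≤ M → rowNormOn jV (F M \ F N) v ≤ τ N
  col_tail : ∀ N M, N ≤ M → colNormOn jW (F M \ F N) w ≤ τ N

namespace RowColumnSeries

variable {jV : OperatorSpaceStructure V H} {jW : OperatorSpaceStructure W K}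
    [DecidableEq ι] {F : ℕ → Finset ι} {v : ι → V} {w : ι → W} {τ : ℕ → ℝ}

theorem row_le (h : RowColumnSeries jV jW F v w τ) (N : ℕ) : rowNormOn jV (F N) v ≤ τ 0 := by
  simpa [h.zero] using h.row_tail 0 N N.zero_le

theorem col_le (h : RowColumnSeries jV jW F v w τ) (N : ℕ) : colNormOn jW (F N) w ≤ τ 0 := by
  simpa [h.zero] using h.col_tail 0 N N.zero_le

/-- If a separating set of functionals `φ` gives `∑ φ(vᵢ) wᵢ = 0`, then `∑ vᵢ ⊗ wᵢ = 0`: split `ℓ²`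
along the closed span of the sequences conjugate to `(φ(vᵢ))`. -/
theorem tendsto_zero_of_right [CompleteSpace V] (h : RowColumnSeries jV jW F v w τ)
    (S : Set (StrongDual ℂ V)) (hS : ∀ x, (∀ φ ∈ S, φ x = 0) → x = 0)
    (h0 : ∀ φ ∈ S, Tendsto (fun N => ∑ i ∈ F N, φ (v i) • w i) atTop (𝓝 0)) :
    Tendsto (fun N => haagerupNorm jV jW (∑ i ∈ F N, v i ⊗ₜ[ℂ] w i)) atTop (𝓝 0) := by
  have hmem : ∀ φ : StrongDual ℂ V, Memℓp (fun i => star (φ (v i))) 2 := fun φ =>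
    memℓp_of_sum_le h.exhaust _ (‖φ‖ * τ 0) fun N => by
      simp only [norm_star]
      exact (sqrt_sum_sq_le_rowOn jV φ (F N) v).trans
        (mul_le_mul_of_nonneg_left (h.row_le N) (norm_nonneg _))
  let m : StrongDual ℂ V → lp (fun _ : ι => ℂ) 2 := fun φ => ⟨_, hmem φ⟩
  have hm : ∀ φ i, (m φ) i = star (φ (v i)) := fun φ i => rfl
  refine tendsto_haagerupNorm_zero_of_orthogonal jV jW h.mono h.zero v w h.tendsto h.row_tail
    h.col_tail (Submodule.span ℂ (m '' S)).topologicalClosure (fun c hc => ?_) (fun c hc => ?_)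
  · refine tendsto_zero_iff_norm_tendsto_zero.mpr ?_
    refine tendsto_seminorm_of_mem_closure_span (fun N => starSumSeminorm (F N) w) (τ 0)
      (fun N c => ?_) (m '' S) ?_ hc
    · refine (norm_sum_smul_le_colOn jW (F N) (fun i => star (c i)) w).trans ?_
      simp only [norm_star]
      rw [mul_comm]
      exact mul_le_mul (h.col_le N) (sum_norm_sq_le_lp c _) (Real.sqrt_nonneg _)
        ((colNormOn_nonneg _ _ _).trans (h.col_le N))
    · rintro _ ⟨φ, hφ, rfl⟩
      refine (tendsto_zero_iff_norm_tendsto_zero.mp (h0 φ hφ)).congr fun N => ?_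
      change _ = ‖∑ i ∈ F N, star ((m φ) i) • w i‖
      simp only [hm, star_star]
  · refine tendsto_zero_of_separating S hS _
      (cauchySeq_sum_of_tail h.mono h.tendsto _ ‖c‖ fun N M hNM => ?_) fun φ hφ => ?_
    · exact (norm_sum_smul_le_rowOn jV _ (fun i => c i) v).trans
        (mul_le_mul (sum_norm_sq_le_lp c _) (h.row_tail N M hNM) (rowNormOn_nonneg _ _ _)
          (norm_nonneg _))
    · have h1 := tendsto_inner_lp h.exhaust (m φ) c
      rw [hc (m φ) (Submodule.le_topologicalClosure _
        (Submodule.subset_span (Set.mem_image_of_mem m hφ)))] at h1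
      refine h1.congr fun N => ?_
      simp only [hm, star_star, map_sum, map_smul, smul_eq_mul, mul_comm]

/-- The mirror image of `tendsto_zero_of_right`: `ℓ²` is split along the closed span of the
sequences `(ψ(wᵢ))`, which now annihilates the row and whose orthogonal complement annihilates the
column. -/
theorem tendsto_zero_of_left [CompleteSpace W] (h : RowColumnSeries jV jW F v w τ)
    (S : Set (StrongDual ℂ W)) (hS : ∀ x, (∀ ψ ∈ S, ψ x = 0) → x = 0)
    (h0 : ∀ ψ ∈ S, Tendsto (fun N => ∑ i ∈ F N, ψ (w i) • v i) atTop (𝓝 0)) :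
    Tendsto (fun N => haagerupNorm jV jW (∑ i ∈ F N, v i ⊗ₜ[ℂ] w i)) atTop (𝓝 0) := by
  have hmem : ∀ ψ : StrongDual ℂ W, Memℓp (fun i => ψ (w i)) 2 := fun ψ =>
    memℓp_of_sum_le h.exhaust _ (‖ψ‖ * τ 0) fun N =>
      (sqrt_sum_sq_le_colOn jW ψ (F N) w).trans
        (mul_le_mul_of_nonneg_left (h.col_le N) (norm_nonneg _))
  let m : StrongDual ℂ W → lp (fun _ : ι => ℂ) 2 := fun ψ => ⟨_, hmem ψ⟩
  have hm : ∀ ψ i, (m ψ) i = ψ (w i) := fun ψ i => rfl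
  set N₀ := (Submodule.span ℂ (m '' S)).topologicalClosure with hN₀
  have hcl : IsClosed (N₀ : Set (lp (fun _ : ι => ℂ) 2)) := Submodule.isClosed_topologicalClosure _
  have : CompleteSpace N₀ := hcl.completeSpace_coe
  refine tendsto_haagerupNorm_zero_of_orthogonal jV jW h.mono h.zero v w h.tendsto h.row_tail
    h.col_tail N₀ᗮ (fun c hc => ?_) (fun c hc => ?_)
  · refine tendsto_zero_of_separating S hS _
      (cauchySeq_sum_of_tail h.mono h.tendsto _ ‖c‖ fun N M hNM => ?_) fun ψ hψ => ?_
    · refine (norm_sum_smul_le_colOn jW _ (fun i => star (c i)) w).trans ?_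
      simp only [norm_star]
      exact mul_le_mul (sum_norm_sq_le_lp c _) (h.col_tail N M hNM) (colNormOn_nonneg _ _ _)
          (norm_nonneg _)
    · have h1 := tendsto_inner_lp h.exhaust c (m ψ)
      rw [inner_eq_zero_symm.mp (hc (m ψ) (Submodule.le_topologicalClosure _
        (Submodule.subset_span (Set.mem_image_of_mem m hψ))))] at h1
      refine h1.congr fun N => ?_
      simp only [hm, map_sum, map_smul, smul_eq_mul]
  · rw [Submodule.orthogonal_orthogonal] at hc
    refine tendsto_zero_iff_norm_tendsto_zero.mpr ?_
    refine tendsto_seminorm_of_mem_closure_span (fun N => sumSeminorm (F N) v) (τ 0)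
      (fun N c => ?_) (m '' S) ?_ hc
    · refine (norm_sum_smul_le_rowOn jV (F N) (fun i => c i) v).trans ?_
      rw [mul_comm]
      exact mul_le_mul (h.row_le N) (sum_norm_sq_le_lp c _) (Real.sqrt_nonneg _)
        ((rowNormOn_nonneg _ _ _).trans (h.row_le N))
    · rintro _ ⟨ψ, hψ, rfl⟩
      exact tendsto_zero_iff_norm_tendsto_zero.mp (h0 ψ hψ)

end RowColumnSeries

/-- Every element of `V ⊗_h W` is the sum of a series of elementary tensors with norm-convergent
row and column. -/
theorem exists_rowColumnSeries (jV : OperatorSpaceStructure V H) (jW : OperatorSpaceStructure W K)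
    (y : HaagerupTensor jV jW) :
    ∃ (n : ℕ → ℕ) (F : ℕ → Finset (Σ k, Fin (n k))) (v : (Σ k, Fin (n k)) → V)
      (w : (Σ k, Fin (n k)) → W) (τ : ℕ → ℝ), RowColumnSeries jV jW F v w τ ∧
      Tendsto (fun N => (((AlgTensor.equiv jV jW).symm (∑ i ∈ F N, v i ⊗ₜ[ℂ] w i) :
        AlgTensor jV jW) : HaagerupTensor jV jW)) atTop (𝓝 y) := by
  obtain ⟨a, ha, -, ha'⟩ := controlled_sum_of_mem_closure_range
    (j := (UniformSpace.Completion.toComplL :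
      AlgTensor jV jW →L[ℂ] HaagerupTensor jV jW).toLinearMap.toAddMonoidHom) (b := y)
    (UniformSpace.Completion.denseRange_coe y) (f := fun k => (1 / 2 : ℝ) ^ k)
    (fun k => by positivity)
  have hna : ∀ k, 0 < k → haagerupNorm jV jW (AlgTensor.equiv jV jW (a k)) < (1 / 2 : ℝ) ^ k := by
    intro k hk
    rw [← norm_algTensor, ← UniformSpace.Completion.norm_coe]
    exact ha' k hk
  -- the first term is not small, but only tails matter
  let r : ℕ → ℝ := fun k =>
    (1 / 2 : ℝ) ^ k + if k = 0 then haagerupNorm jV jW (AlgTensor.equiv jV jW (a 0)) else 0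
  have hr : ∀ k, haagerupNorm jV jW (AlgTensor.equiv jV jW (a k)) < r k := by
    intro k
    rcases Nat.eq_zero_or_pos k with rfl | hk
    · simp [r]
    · simpa [r, hk.ne'] using hna k hk
  have hr0 : ∀ k, 0 ≤ r k := fun k => (haagerupNorm_nonneg _ _ _).trans (hr k).le
  have hrs : Summable r :=
    (summable_geometric_of_lt_one (by norm_num) (by norm_num)).add
      (summable_of_ne_finset_zero (s := {0}) fun k hk => if_neg (by simpa using hk))
  -- balanced representations of the terms give a row and a column whose squares are summable
  choose n v w hu hv hw using fun k => exists_balanced_rep jV jW _ (r k) (hr k)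
  let F : ℕ → Finset (Σ k, Fin (n k)) := fun N =>
    (Finset.range N).sigma fun _ => Finset.univ
  have hsd : ∀ N M, F M \ F N = (Finset.range M \ Finset.range N).sigma fun _ => Finset.univ := by
    intro N M
    ext ⟨k, i⟩
    simp [F]
  let t : ℕ → ℝ := fun N => ∑' k, r (k + N)
  have hsum : ∀ N M, ∑ k ∈ Finset.range M \ Finset.range N, r k ≤ t N := by
    intro N M
    have h1 : Summable fun k => r (k + N) := (summable_nat_add_iff N).mpr hrs
    have h2 : Finset.range M \ Finset.range N ⊆ (Finset.range M).image (· + N) := by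
      intro k hk
      simp only [Finset.mem_sdiff, Finset.mem_range, not_lt, Finset.mem_image] at hk ⊢
      exact ⟨k - N, by omega, by omega⟩
    refine (Finset.sum_le_sum_of_subset_of_nonneg h2 fun k _ _ => hr0 k).trans ?_
    rw [Finset.sum_image fun x _ y _ h => by simpa using h]
    exact h1.sum_le_tsum _ fun k _ => hr0 _
  have hmono : Monotone F := fun N M hNM => by
    intro ⟨k, i⟩ hk
    simp only [F, Finset.mem_sigma, Finset.mem_range, Finset.mem_univ, and_true] at hk ⊢
    omega
  refine ⟨n, F, fun x => v x.1 x.2, fun x => w x.1 x.2, fun N => Real.sqrt (t N),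
    ⟨hmono, ?_, ?_, ?_, fun N M _ => ?_, fun N M _ => ?_⟩, ?_⟩
  · simp [F]
  · refine tendsto_atTop_finset_of_monotone hmono fun x => ⟨x.1 + 1, ?_⟩
    simp [F]
  · have h := (Real.continuous_sqrt.tendsto 0).comp (tendsto_sum_nat_add r)
    rw [Real.sqrt_zero] at h
    exact h
  · refine Real.sqrt_le_sqrt (le_trans ?_ (hsum N M))
    rw [hsd, Finset.sum_sigma]
    refine (norm_sum_le _ _).trans (Finset.sum_le_sum fun k _ => ?_)
    simpa [rowNorm, Real.sq_sqrt (norm_nonneg _)] using hv k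
  · refine Real.sqrt_le_sqrt (le_trans ?_ (hsum N M))
    rw [hsd, Finset.sum_sigma]
    refine (norm_sum_le _ _).trans (Finset.sum_le_sum fun k _ => ?_)
    simpa [colNorm, Real.sq_sqrt (norm_nonneg _)] using hw k
  · rw [← tendsto_add_atTop_iff_nat 1]
    refine ha.congr fun N => ?_
    rw [Finset.sum_sigma]
    simp only [← hu]
    rw [← map_sum, ← map_sum, LinearEquiv.symm_apply_apply]
    rfl

/-! ### Slice maps of separating sets -/

theorem rightSlice_coe [CompleteSpace W] (jV : OperatorSpaceStructure V H)
    (jW : OperatorSpaceStructure W K) (φ : StrongDual ℂ V) (u : V ⊗[ℂ] W) :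
    rightSlice jV jW φ (((AlgTensor.equiv jV jW).symm u : AlgTensor jV jW) :
      HaagerupTensor jV jW) = rightSliceLin φ u :=
  ContinuousLinearMap.extend_eq (rightSliceAlg jV jW φ)
    (e := (UniformSpace.Completion.toComplL : AlgTensor jV jW →L[ℂ] HaagerupTensor jV jW))
    UniformSpace.Completion.denseRange_coe
    (UniformSpace.Completion.isUniformInducing_coe _) ((AlgTensor.equiv jV jW).symm u)

theorem leftSlice_coe [CompleteSpace V] (jV : OperatorSpaceStructure V H)
    (jW : OperatorSpaceStructure W K) (ψ : StrongDual ℂ W) (u : V ⊗[ℂ] W) :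
    leftSlice jV jW ψ (((AlgTensor.equiv jV jW).symm u : AlgTensor jV jW) :
      HaagerupTensor jV jW) = leftSliceLin ψ u :=
  ContinuousLinearMap.extend_eq (leftSliceAlg jV jW ψ)
    (e := (UniformSpace.Completion.toComplL : AlgTensor jV jW →L[ℂ] HaagerupTensor jV jW))
    UniformSpace.Completion.denseRange_coe
    (UniformSpace.Completion.isUniformInducing_coe _) ((AlgTensor.equiv jV jW).symm u)

theorem eq_zero_of_tendsto_haagerupNorm {jV : OperatorSpaceStructure V H}
    {jW : OperatorSpaceStructure W K} {u : ℕ → V ⊗[ℂ] W} {y : HaagerupTensor jV jW}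
    (hu : Tendsto (fun N => (((AlgTensor.equiv jV jW).symm (u N) :
        AlgTensor jV jW) : HaagerupTensor jV jW)) atTop (𝓝 y))
    (h : Tendsto (fun N => haagerupNorm jV jW (u N)) atTop (𝓝 0)) : y = 0 := by
  refine tendsto_nhds_unique hu (tendsto_zero_iff_norm_tendsto_zero.mpr (h.congr fun N => ?_))
  rw [UniformSpace.Completion.norm_coe, norm_algTensor, LinearEquiv.apply_symm_apply]

/-- The slice maps of any separating set of functionals on `V` separate the points of
`V ⊗_h W`. -/
theorem rightSlice_separates [CompleteSpace V] [CompleteSpace W]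
    (jV : OperatorSpaceStructure V H) (jW : OperatorSpaceStructure W K)
    (S : Set (StrongDual ℂ V)) (hS : ∀ x, (∀ φ ∈ S, φ x = 0) → x = 0)
    (y z : HaagerupTensor jV jW) (h : ∀ φ ∈ S, rightSlice jV jW φ y = rightSlice jV jW φ z) :
    y = z := by
  classical
  obtain ⟨n, F, v, w, τ, hs, hy⟩ := exists_rowColumnSeries jV jW (y - z)
  refine sub_eq_zero.mp (eq_zero_of_tendsto_haagerupNorm hy
    (hs.tendsto_zero_of_right S hS fun φ hφ => ?_))
  have h1 := ((rightSlice jV jW φ).continuous.tendsto _).comp hy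
  rw [map_sub, h φ hφ, sub_self] at h1
  refine h1.congr fun N => ?_
  rw [Function.comp_apply, rightSlice_coe, map_sum]
  simp only [rightSliceLin_tmul]

/-- The slice maps of any separating set of functionals on `W` separate the points of
`V ⊗_h W`. -/
theorem leftSlice_separates [CompleteSpace V] [CompleteSpace W]
    (jV : OperatorSpaceStructure V H) (jW : OperatorSpaceStructure W K)
    (S : Set (StrongDual ℂ W)) (hS : ∀ x, (∀ ψ ∈ S, ψ x = 0) → x = 0)
    (y z : HaagerupTensor jV jW) (h : ∀ ψ ∈ S, leftSlice jV jW ψ y = leftSlice jV jW ψ z) :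
    y = z := by
  classical
  obtain ⟨n, F, v, w, τ, hs, hy⟩ := exists_rowColumnSeries jV jW (y - z)
  refine sub_eq_zero.mp (eq_zero_of_tendsto_haagerupNorm hy
    (hs.tendsto_zero_of_left S hS fun ψ hψ => ?_))
  have h1 := ((leftSlice jV jW ψ).continuous.tendsto _).comp hy
  rw [map_sub, h ψ hψ, sub_self] at h1
  refine h1.congr fun N => ?_
  rw [Function.comp_apply, leftSlice_coe, map_sum]
  simp only [leftSliceLin_tmul]

end SliceSeparation

section PureStates

/-! ### Iterated squares -/

/-- If `bₙ² ≤ a bₙ₊₁` and `bₙ` grows at most like `r ^ 2ⁿ`, then `b₀ ≤ a r`.  With `bₙ` the values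
of a positive form at iterated squares, this replaces the spectral radius formula. -/
theorem le_mul_of_sq_le_mul_succ {b : ℕ → ℝ} {a K r : ℝ} (ha : 0 ≤ a) (hr : 0 ≤ r)
    (h1 : ∀ n, b n ^ 2 ≤ a * b (n + 1)) (h2 : ∀ n, b n ≤ K * r ^ 2 ^ n) : b 0 ≤ a * r := by
  by_contra! hlt
  have hb0 : 0 < b 0 := (mul_nonneg ha hr).trans_lt hlt
  have ha' : 0 < a := by
    rcases ha.eq_or_lt with rfl | h
    · have := h1 0
      rw [zero_mul] at this
      nlinarith
    · exact h
  -- otherwise `bₙ ≥ a s ^ 2ⁿ` with `s = b₀ / a > r`, which outgrows `r ^ 2ⁿ`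
  set s := b 0 / a with hs
  have hrs : r < s := by rwa [hs, lt_div_iff₀ ha', mul_comm]
  have hs0 : 0 < s := hr.trans_lt hrs
  have key : ∀ n, a * s ^ 2 ^ n ≤ b n := by
    intro n
    induction n with
    | zero => rw [pow_zero, pow_one, hs, mul_div_cancel₀ _ ha'.ne']
    | succ n ih =>
      refine le_of_mul_le_mul_left ?_ ha'
      refine le_trans ?_ (h1 n)
      calc a * (a * s ^ 2 ^ (n + 1)) = (a * s ^ 2 ^ n) ^ 2 := by ring
        _ ≤ b n ^ 2 := pow_le_pow_left₀ (by positivity) ih 2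
  have key2 : ∀ n, a * s ^ 2 ^ n ≤ K * r ^ 2 ^ n := fun n => (key n).trans (h2 n)
  rcases hr.eq_or_lt with rfl | hr'
  · have := key2 0
    simp only [pow_zero, pow_one, mul_zero] at this
    nlinarith
  · obtain ⟨n, hn⟩ := pow_unbounded_of_one_lt (K / a) ((one_lt_div hr').mpr hrs)
    have h3 : (s / r) ^ n ≤ (s / r) ^ 2 ^ n :=
      pow_le_pow_right₀ ((one_lt_div hr').mpr hrs).le Nat.lt_two_pow_self.le
    have h4 := hn.trans_le h3
    rw [div_pow, div_lt_div_iff₀ ha' (by positivity)] at h4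
    linarith [key2 n]

universe u

variable {A : Type u} [NonUnitalNormedRing A]

/-- Iterated squaring, `h ^ 2ⁿ`, which makes sense without a unit. -/
def iterSq (h : A) : ℕ → A
  | 0 => h
  | n + 1 => iterSq h n * iterSq h n

theorem norm_iterSq_le (h : A) (n : ℕ) : ‖iterSq h n‖ ≤ ‖h‖ ^ 2 ^ n := by
  induction n with
  | zero => simp [iterSq]
  | succ n ih =>
    calc ‖iterSq h n * iterSq h n‖ ≤ ‖iterSq h n‖ * ‖iterSq h n‖ := norm_mul_le _ _
      _ ≤ ‖h‖ ^ 2 ^ n * ‖h‖ ^ 2 ^ n := mul_le_mul ih ih (norm_nonneg _) (by positivity)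
      _ = ‖h‖ ^ 2 ^ (n + 1) := by ring

variable [StarRing A]

theorem star_iterSq {h : A} (hh : star h = h) (n : ℕ) : star (iterSq h n) = iterSq h n := by
  induction n with
  | zero => exact hh
  | succ n ih => rw [iterSq, star_mul, ih]

variable [NormedSpace ℂ A]

/-! ### The semi-inner product of a positive form -/

section PreGNS

variable [IsScalarTower ℂ A A] [SMulCommClass ℂ A A] [StarModule ℂ A]

/-- Polarization: the form `(x, y) ↦ f (x* y)` is Hermitian. -/
theorem IsPositiveForm.conj_symm {f : StrongDual ℂ A} (hf : IsPositiveForm f) (x y : A) :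
    starRingEnd ℂ (f (star y * x)) = f (star x * y) := by
  have hx := (hf x).2
  have hy := (hf y).2
  have h1 := (hf (x + y)).2
  have h2 := (hf (x + Complex.I • y)).2
  simp only [star_add, star_smul, add_mul, mul_add, map_add, smul_mul_assoc, mul_smul_comm,
    map_smul, smul_eq_mul, Complex.star_def, Complex.conj_I, Complex.add_im, Complex.mul_im,
    Complex.mul_re, Complex.neg_re, Complex.neg_im, Complex.I_re, Complex.I_im] at h1 h2
  apply Complex.ext
  · rw [Complex.conj_re]; linarith
  · rw [Complex.conj_im]; linarith

/-- The algebra `A` with the semi-inner product `⟪x, y⟫ = f (x* y)` of a positive form `f`. -/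
def PreGNS {f : StrongDual ℂ A} (_hf : IsPositiveForm f) : Type u := A

variable {f : StrongDual ℂ A} (hf : IsPositiveForm f)

instance : AddCommGroup (PreGNS hf) := inferInstanceAs (AddCommGroup A)

instance : Module ℂ (PreGNS hf) := inferInstanceAs (Module ℂ A)

/-- The identity map from `A` to `PreGNS hf`. -/
def toPreGNS : A ≃ₗ[ℂ] PreGNS hf := LinearEquiv.refl ℂ A

/-- The semi-inner product `⟪x, y⟫ = f (x* y)`. -/
abbrev preGNSCore : PreInnerProductSpace.Core ℂ (PreGNS hf) where
  inner x y := f (star ((toPreGNS hf).symm x) * (toPreGNS hf).symm y)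
  conj_inner_symm x y := hf.conj_symm _ _
  re_inner_nonneg x := (hf _).1
  add_left x y z := by rw [map_add, star_add, add_mul, map_add]
  smul_left x y c := by simp [smul_mul_assoc]

instance : SeminormedAddCommGroup (PreGNS hf) :=
  InnerProductSpace.Core.toSeminormedAddCommGroup (c := preGNSCore hf)

instance : InnerProductSpace ℂ (PreGNS hf) := InnerProductSpace.ofCore (preGNSCore hf)

theorem inner_toPreGNS (x y : A) :
    inner ℂ (toPreGNS hf x) (toPreGNS hf y) = f (star x * y) := rfl

theorem norm_toPreGNS_sq (x : A) : ‖toPreGNS hf x‖ ^ 2 = (f (star x * x)).re := by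
  rw [← inner_self_eq_norm_sq (𝕜 := ℂ), inner_toPreGNS]; rfl

/-- The Cauchy–Schwarz inequality for positive forms. -/
theorem IsPositiveForm.norm_sq_le {f : StrongDual ℂ A} (hf : IsPositiveForm f) (x y : A) :
    ‖f (star y * x)‖ ^ 2 ≤ (f (star y * y)).re * (f (star x * x)).re := by
  rw [← norm_toPreGNS_sq hf, ← norm_toPreGNS_sq hf, ← inner_toPreGNS hf, ← mul_pow]
  exact pow_le_pow_left₀ (norm_nonneg _) (norm_inner_le_norm _ _) 2

end PreGNS

/-! ### Quasi-states -/

/-- A positive form with `|f x|² ≤ f (x* x)`; on a Banach `*`-algebra these are the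
forms `x ↦ ⟪ξ, π x ξ⟫` with `π` a `*`-representation and `‖ξ‖ ≤ 1`. -/
structure IsQuasiState (f : StrongDual ℂ A) : Prop where
  positive : IsPositiveForm f
  norm_sq_le : ∀ x, ‖f x‖ ^ 2 ≤ (f (star x * x)).re

theorem IsPositiveForm.smul {f : StrongDual ℂ A} (hf : IsPositiveForm f) {c : ℝ} (hc : 0 ≤ c) :
    IsPositiveForm ((c : ℂ) • f) := fun x => by
  have h := hf x
  simp only [smul_apply, smul_eq_mul, Complex.re_ofReal_mul, Complex.im_ofReal_mul]
  exact ⟨mul_nonneg hc h.1, by rw [h.2, mul_zero]⟩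

theorem IsPositiveForm.add {f g : StrongDual ℂ A} (hf : IsPositiveForm f)
    (hg : IsPositiveForm g) : IsPositiveForm (f + g) := fun x => by
  have h := hf x
  have h' := hg x
  simp only [add_apply, Complex.add_re, Complex.add_im]
  exact ⟨add_nonneg h.1 h'.1, by rw [h.2, h'.2, add_zero]⟩

/-- Normalization: the least constant in `|p x|² ≤ C p (x* x)` plays the role of the norm of `p`. -/
theorem isQuasiState_smul {p : StrongDual ℂ A} (hp : IsPositiveForm p) {C : ℝ} (hC : 0 < C)
    (h : ∀ x, ‖p x‖ ^ 2 ≤ C * (p (star x * x)).re) : IsQuasiState (((C⁻¹ : ℝ) : ℂ) • p) where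
  positive := hp.smul (inv_nonneg.mpr hC.le)
  norm_sq_le x := by
    simp only [smul_apply, smul_eq_mul, Complex.re_ofReal_mul, norm_mul, Complex.norm_real,
      Real.norm_of_nonneg (inv_nonneg.mpr hC.le), mul_pow]
    calc C⁻¹ ^ 2 * ‖p x‖ ^ 2 ≤ C⁻¹ ^ 2 * (C * (p (star x * x)).re) :=
          mul_le_mul_of_nonneg_left (h x) (by positivity)
      _ = C⁻¹ * (p (star x * x)).re := by field_simp

variable (A) in
/-- The set of quasi-states, in the weak-* topology. -/
def quasiStates : Set (WeakDual ℂ A) := {f | IsQuasiState (WeakDual.toStrongDual f)}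

theorem isClosed_quasiStates : IsClosed (quasiStates A) := by
  have hev : ∀ x : A, Continuous fun f : WeakDual ℂ A => f x := WeakDual.eval_continuous
  have e : quasiStates A = {f : WeakDual ℂ A | ∀ x : A, (0 ≤ (f (star x * x)).re ∧
      (f (star x * x)).im = 0) ∧ ‖f x‖ ^ 2 ≤ (f (star x * x)).re} := by
    ext f
    exact ⟨fun h x => ⟨h.1 x, h.2 x⟩, fun h => ⟨fun x => (h x).1, fun x => (h x).2⟩⟩
  rw [e, Set.ofPred_forall]
  refine isClosed_iInter fun x => IsClosed.and (IsClosed.and ?_ ?_) ?_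
  · exact isClosed_le continuous_const (Complex.continuous_re.comp (hev _))
  · exact isClosed_eq (Complex.continuous_im.comp (hev _)) continuous_const
  · exact isClosed_le ((hev x).norm.pow 2) (Complex.continuous_re.comp (hev _))

theorem convex_quasiStates : Convex ℝ (quasiStates A) := by
  intro f hf g hg a b ha hb hab
  have hval : ∀ x : A, (a • f + b • g) x = a * f x + b * g x := fun x => rfl
  refine ⟨?_, fun x => ?_⟩
  · exact (hf.1.smul ha).add (hg.1.smul hb)
  · change ‖(a • f + b • g) x‖ ^ 2 ≤ ((a • f + b • g) (star x * x)).re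
    rw [hval, hval, Complex.add_re, Complex.re_ofReal_mul, Complex.re_ofReal_mul]
    have h1 : ‖(a : ℂ) * f x + b * g x‖ ≤ a * ‖f x‖ + b * ‖g x‖ := by
      refine (norm_add_le _ _).trans (le_of_eq ?_)
      rw [norm_mul, norm_mul, Complex.norm_real, Complex.norm_real, Real.norm_of_nonneg ha,
        Real.norm_of_nonneg hb]
    have h2 : (a * ‖f x‖ + b * ‖g x‖) ^ 2 ≤ a * ‖f x‖ ^ 2 + b * ‖g x‖ ^ 2 := by
      obtain rfl : b = 1 - a := by linarith
      nlinarith [mul_nonneg (mul_nonneg ha hb) (sq_nonneg (‖f x‖ - ‖g x‖))]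
    have h3 := mul_le_mul_of_nonneg_left (hf.2 x) ha
    have h4 := mul_le_mul_of_nonneg_left (hg.2 x) hb
    exact ((pow_le_pow_left₀ (norm_nonneg _) h1 2).trans h2).trans (add_le_add h3 h4)

variable [NormedStarGroup A]

/-- The bound on `f` is automatic: iterating `|f h|² ≤ f (h²)` for `h = x* x` gives
`|f h| ≤ ‖h‖`. -/
theorem IsQuasiState.norm_le_one {f : StrongDual ℂ A} (hf : IsQuasiState f) :
    ‖f‖ ≤ 1 := by
  refine f.opNorm_le_bound zero_le_one fun x => ?_
  rw [one_mul]
  refine abs_le_of_sq_le_sq' ?_ (by positivity) |>.2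
  have hs : star (star x * x) = star x * x := by simp
  have key := le_mul_of_sq_le_mul_succ (b := fun n => ‖f (iterSq (star x * x) n)‖)
    (a := 1) (K := ‖f‖) (r := ‖star x * x‖) zero_le_one (norm_nonneg _)
    (fun n => ?_) (fun n => ?_)
  · have h1 : ‖f (star x * x)‖ ≤ 1 * ‖star x * x‖ := key
    have h2 : ‖star x * x‖ ≤ ‖x‖ ^ 2 := by
      refine (norm_mul_le _ _).trans (le_of_eq ?_)
      rw [norm_star, sq]
    linarith [hf.norm_sq_le x, Complex.re_le_norm (f (star x * x))]
  · rw [one_mul]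
    refine (hf.norm_sq_le _).trans ((Complex.re_le_norm _).trans (le_of_eq ?_))
    rw [star_iterSq hs, iterSq]
  · exact (f.le_opNorm _).trans
      (mul_le_mul_of_nonneg_left (norm_iterSq_le _ n) (norm_nonneg _))

theorem isCompact_quasiStates : IsCompact (quasiStates A) :=
  (WeakDual.isCompact_closedBall (𝕜 := ℂ) (E := A) 0 1).of_isClosed_subset isClosed_quasiStates
    fun _ hf => by
      simpa using IsQuasiState.norm_le_one hf

/-- The Krein–Milman theorem in the weak-* topology. -/
theorem closure_convexHull_extremePoints_weakDual {E : Type*} [NormedAddCommGroup E]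
    [NormedSpace ℂ E] {s : Set (WeakDual ℂ E)} (hs : IsCompact s) (hconv : Convex ℝ s) :
    closure (convexHull ℝ (s.extremePoints ℝ)) = s := by
  have : ContinuousSMul ℝ (WeakDual ℂ E) := WeakDual.instContinuousSMul ℝ
  have : LocallyConvexSpace ℝ (WeakDual ℂ E) :=
    inferInstanceAs (LocallyConvexSpace ℝ (WeakBilin (topDualPairing ℂ E)))
  exact closure_convexHull_extremePoints hs hconv

/-- By the Krein–Milman theorem, a point at which some quasi-state does not vanish is detected by
an extreme quasi-state. -/
theorem exists_extremePoint_ne_zero {f : StrongDual ℂ A} (hf : IsQuasiState f)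
    {a : A} (ha : f a ≠ 0) :
    ∃ g ∈ (quasiStates A).extremePoints ℝ, g a ≠ 0 := by
  by_contra! hcon
  have hKM := closure_convexHull_extremePoints_weakDual (isCompact_quasiStates (A := A))
    convex_quasiStates
  have hsub : closure (convexHull ℝ ((quasiStates A).extremePoints ℝ))
      ⊆ {g : WeakDual ℂ A | g a = 0} := by
    refine closure_minimal (convexHull_min hcon ?_)
      (isClosed_eq (WeakDual.eval_continuous a) continuous_const)
    intro g hg h hh s t _ _ _
    have : (s • g + t • h) a = s * g a + t * h a := rfl
    rw [Set.mem_ofPred_eq, this, hg, hh, mul_zero, mul_zero, add_zero]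
  rw [hKM] at hsub
  exact ha (hsub (show StrongDual.toWeakDual f ∈ quasiStates A from hf))

variable [IsScalarTower ℂ A A] [SMulCommClass ℂ A A]

/-! ### Forms given by representations -/

/-- A `*`-representation of a Banach `*`-algebra is contractive: `π` shrinks spectra, and the norm
of the self-adjoint operator `π (x* x)` is its spectral radius. -/
theorem norm_starRepresentation_le [CompleteSpace A] {E : Type*} [NormedAddCommGroup E]
    [InnerProductSpace ℂ E] [CompleteSpace E] (π : A →⋆ₙₐ[ℂ] (E →L[ℂ] E)) (x : A) :
    ‖π x‖ ≤ ‖x‖ := by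
  set h := star x * x with hh
  have hspec : ∀ k ∈ spectrum ℂ (π h), ‖k‖ ≤ ‖h‖ := by
    intro k hk
    have h1 : k ∈ quasispectrum ℂ h :=
      NonUnitalAlgHom.quasispectrum_apply_subset (R := ℂ) π h
        (spectrum_subset_quasispectrum ℂ _ hk)
    rw [Unitization.quasispectrum_eq_spectrum_inr,
      ← AlgEquiv.spectrum_eq (WithLp.unitizationAlgEquiv (𝕜 := ℂ) (A := A) ℂ).symm] at h1
    have h2 := spectrum.norm_le_norm_mul_of_mem h1
    have h3 : ‖(1 : WithLp 1 (Unitization ℂ A))‖ = 1 := by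
      rw [WithLp.unitization_norm_def]
      change ‖(1 : ℂ)‖ + ‖(0 : A)‖ = 1
      simp
    rw [h3, mul_one] at h2
    exact h2.trans (le_of_eq (WithLp.unitization_norm_inr h))
  have hsa : IsSelfAdjoint (π h) := (IsSelfAdjoint.star_mul_self x).map π
  have hle : ‖π h‖ ≤ ‖h‖ := by
    have h1 := hsa.spectralRadius_eq_nnnorm
    have h2 : spectralRadius ℂ (π h) ≤ ‖h‖₊ :=
      iSup₂_le fun k hk => by exact_mod_cast hspec k hk
    rw [h1] at h2
    exact_mod_cast h2
  rw [hh, map_mul, map_star, CStarRing.norm_star_mul_self] at hle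
  have h4 : ‖star x * x‖ ≤ ‖x‖ * ‖x‖ := (norm_mul_le _ _).trans (by rw [norm_star])
  exact abs_le_of_sq_le_sq' (by nlinarith) (norm_nonneg _) |>.2

/-- The form `x ↦ ⟪ξ, π x ξ⟫`. -/
def vectorForm [CompleteSpace A] {E : Type*} [NormedAddCommGroup E]
    [InnerProductSpace ℂ E] [CompleteSpace E] (π : A →⋆ₙₐ[ℂ] (E →L[ℂ] E)) (ξ : E) :
    StrongDual ℂ A :=
  LinearMap.mkContinuous
    { toFun := fun x => inner ℂ ξ (π x ξ)
      map_add' := fun x y => by rw [map_add, add_apply, inner_add_right]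
      map_smul' := fun c x => by
        rw [map_smul, smul_apply, inner_smul_right, RingHom.id_apply, smul_eq_mul] }
    (‖ξ‖ * ‖ξ‖) fun x => by
      refine (norm_inner_le_norm _ _).trans ?_
      have := (π x).le_of_opNorm_le (norm_starRepresentation_le π x) ξ
      nlinarith [mul_le_mul_of_nonneg_left this (norm_nonneg ξ)]

theorem vectorForm_apply [CompleteSpace A] {E : Type*} [NormedAddCommGroup E]
    [InnerProductSpace ℂ E] [CompleteSpace E] (π : A →⋆ₙₐ[ℂ] (E →L[ℂ] E)) (ξ : E) (x : A) :
    vectorForm π ξ x = inner ℂ ξ (π x ξ) := rfl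

theorem isQuasiState_vectorForm [CompleteSpace A] {E : Type*} [NormedAddCommGroup E]
    [InnerProductSpace ℂ E] [CompleteSpace E] (π : A →⋆ₙₐ[ℂ] (E →L[ℂ] E)) {ξ : E}
    (hξ : ‖ξ‖ ≤ 1) : IsQuasiState (vectorForm π ξ) := by
  have e : ∀ x, vectorForm π ξ (star x * x) = ((‖π x ξ‖ ^ 2 : ℝ) : ℂ) := fun x => by
    rw [vectorForm_apply, map_mul, map_star, mul_apply_eq_comp,
      ContinuousLinearMap.star_eq_adjoint, ContinuousLinearMap.adjoint_inner_right,
      inner_self_eq_norm_sq_to_K]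
    push_cast
    rfl
  refine ⟨fun x => ?_, fun x => ?_⟩
  · rw [e]
    exact ⟨by rw [Complex.ofReal_re]; positivity, Complex.ofReal_im _⟩
  · rw [e, Complex.ofReal_re, vectorForm_apply]
    refine pow_le_pow_left₀ (norm_nonneg _) ((norm_inner_le_norm _ _).trans ?_) 2
    exact mul_le_of_le_one_left (norm_nonneg _) hξ

/-! ### Approximating the cyclic vector of a quasi-state -/

variable [StarModule ℂ A]

/-- Left multiplication is bounded for the semi-norm of a continuous positive form. -/
theorem norm_toPreGNS_mul_le {f : StrongDual ℂ A} (hf : IsPositiveForm f) (z y : A) :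
    ‖toPreGNS hf (z * y)‖ ≤ ‖z‖ * ‖toPreGNS hf y‖ := by
  refine abs_le_of_sq_le_sq' ?_ (by positivity) |>.2
  set h := star z * z with hh
  have hs : star h = h := by simp [hh]
  have hn : ‖h‖ ≤ ‖z‖ ^ 2 := by
    refine (norm_mul_le _ _).trans (le_of_eq ?_)
    rw [norm_star, sq]
  have h0 : (f (star (z * y) * (z * y))).re = (f (star y * (iterSq h 0 * y))).re := by
    rw [iterSq, hh, star_mul]; simp only [mul_assoc]
  have key := le_mul_of_sq_le_mul_succ (b := fun n => (f (star y * (iterSq h n * y))).re)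
    (a := (f (star y * y)).re) (K := ‖f‖ * ‖y‖ ^ 2) (r := ‖h‖) (hf y).1 (norm_nonneg _)
    (fun n => ?_) (fun n => ?_)
  · rw [mul_pow, norm_toPreGNS_sq, norm_toPreGNS_sq, h0, mul_comm]
    exact key.trans (mul_le_mul_of_nonneg_left hn (hf y).1)
  · have h1 := hf.norm_sq_le (iterSq h n * y) y
    have h2 : star (iterSq h n * y) * (iterSq h n * y) = star y * (iterSq h (n + 1) * y) := by
      rw [star_mul, star_iterSq hs, iterSq]; simp only [mul_assoc]
    rw [h2] at h1
    refine le_trans ?_ h1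
    rw [← sq_abs]
    exact pow_le_pow_left₀ (abs_nonneg _) (Complex.abs_re_le_norm _) 2
  · refine (Complex.re_le_norm _).trans ((f.le_opNorm _).trans ?_)
    rw [mul_assoc]
    refine mul_le_mul_of_nonneg_left ?_ (norm_nonneg _)
    calc ‖star y * (iterSq h n * y)‖ ≤ ‖star y‖ * (‖iterSq h n‖ * ‖y‖) :=
          (norm_mul_le _ _).trans (mul_le_mul_of_nonneg_left (norm_mul_le _ _) (norm_nonneg _))
      _ ≤ ‖y‖ * (‖h‖ ^ 2 ^ n * ‖y‖) := by
          rw [norm_star]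
          gcongr
          exact norm_iterSq_le h n
      _ = ‖y‖ ^ 2 * ‖h‖ ^ 2 ^ n := by ring

/-- In the GNS space of a quasi-state `f`, the functional `[x] ↦ f x` is represented by a vector `ξ`
with `‖ξ‖ ≤ 1` and `π z ξ = [z]`.  The sequence `yₙ` of elements of `A` approximates `ξ`: the norms
`f (yₙ* yₙ)` converge to `ρ = ‖ξ‖²`, and `[z yₙ] → [z]` for every `z`. -/
theorem IsQuasiState.exists_seq {f : StrongDual ℂ A} (hf : IsQuasiState f) :
    ∃ (y : ℕ → A) (ρ : ℝ), ρ ≤ 1 ∧ Tendsto (fun n => (f (star (y n) * y n)).re) atTop (𝓝 ρ) ∧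
      ∀ z, Tendsto (fun n => (f (star (z * y n - z) * (z * y n - z))).re) atTop (𝓝 0) := by
  have hp := hf.positive
  let ι : PreGNS hp →L[ℂ] UniformSpace.Completion (PreGNS hp) := UniformSpace.Completion.toComplL
  have hι : ∀ x, ι x = (x : UniformSpace.Completion (PreGNS hp)) := fun x => rfl
  have hd : DenseRange ι := UniformSpace.Completion.denseRange_coe
  have hu : IsUniformInducing ι := UniformSpace.Completion.isUniformInducing_coe _
  let F : PreGNS hp →L[ℂ] ℂ :=
    (f.toLinearMap ∘ₗ (toPreGNS hp).symm.toLinearMap).mkContinuous 1 fun x => by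
      rw [one_mul]
      refine abs_le_of_sq_le_sq' ?_ (by positivity) |>.2
      have h := hf.norm_sq_le ((toPreGNS hp).symm x)
      rwa [← norm_toPreGNS_sq hp, LinearEquiv.apply_symm_apply] at h
  have hF : ‖F‖ ≤ 1 := LinearMap.mkContinuous_norm_le _ zero_le_one _
  -- the extension `G` of `[x] ↦ f x` to the completion, and the vector `ξ` representing it
  let G := F.extend ι
  have hG : ∀ x : A, G (ι (toPreGNS hp x)) = f x := fun x => F.extend_eq hd hu _
  let ξ := (InnerProductSpace.toDual ℂ (UniformSpace.Completion (PreGNS hp))).symm G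
  have hξ : ∀ x : A, inner ℂ ξ (ι (toPreGNS hp x)) = f x := fun x => by
    rw [InnerProductSpace.toDual_symm_apply, hG]
  have hξ1 : ‖ξ‖ ≤ 1 := by
    rw [LinearIsometryEquiv.norm_map]
    refine G.opNorm_le_bound zero_le_one fun x => ?_
    refine hd.induction_on (p := fun x => ‖G x‖ ≤ 1 * ‖x‖) x
      (isClosed_le G.continuous.norm (continuous_const.mul continuous_norm)) fun x => ?_
    have h := F.le_of_opNorm_le hF x
    rw [show G (ι x) = F x from F.extend_eq hd hu x, hι, UniformSpace.Completion.norm_coe]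
    exact h
  obtain ⟨y', hy', hlim⟩ := mem_closure_iff_seq_limit.mp (hd ξ)
  choose y hy using hy'
  have hlim' : Tendsto (fun n => ι (y n)) atTop (𝓝 ξ) := hlim.congr fun n => (hy n).symm
  refine ⟨fun n => (toPreGNS hp).symm (y n), ‖ξ‖ ^ 2, pow_le_one₀ (norm_nonneg _) hξ1, ?_,
    fun z => ?_⟩
  · refine (hlim'.norm.pow 2).congr fun n => ?_
    rw [hι, UniformSpace.Completion.norm_coe, ← norm_toPreGNS_sq hp, LinearEquiv.apply_symm_apply]
  · -- left multiplication by `z` on the completion sends `ξ` to the class of `z`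
    let T : PreGNS hp →L[ℂ] PreGNS hp :=
      ((toPreGNS hp).toLinearMap ∘ₗ LinearMap.mulLeft ℂ z ∘ₗ
        (toPreGNS hp).symm.toLinearMap).mkContinuous ‖z‖ fun x =>
          norm_toPreGNS_mul_le hp z ((toPreGNS hp).symm x)
    have hT : ∀ x, T x = toPreGNS hp (z * (toPreGNS hp).symm x) := fun x => rfl
    let T' := (ι ∘L T).extend ι
    have hT' : ∀ x, T' (ι x) = ι (T x) := fun x => (ι ∘L T).extend_eq hd hu x
    have h1 : Tendsto (fun n => ι (T (y n))) atTop (𝓝 (T' ξ)) :=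
      ((T'.continuous.tendsto ξ).comp hlim').congr fun n => hT' _
    have h2 : T' ξ = ι (toPreGNS hp z) := by
      -- test against the dense set of classes: `⟪z yₙ, x⟫ = ⟪yₙ, z* x⟫ → f (z* x) = ⟪z, x⟫`
      have h3 : (fun x => inner ℂ (T' ξ) x) = fun x => inner ℂ (ι (toPreGNS hp z)) x := by
        refine hd.equalizer (by fun_prop) (by fun_prop) (funext fun x => ?_)
        have h4 : Tendsto (fun n => inner ℂ (ι (T (y n))) (ι x)) atTop (𝓝 (inner ℂ (T' ξ) (ι x))) :=
          h1.inner tendsto_const_nhds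
        have h5 : Tendsto (fun n => inner ℂ (ι (y n))
            (ι (toPreGNS hp (star z * (toPreGNS hp).symm x)))) atTop
            (𝓝 (f (star z * (toPreGNS hp).symm x))) := by
          rw [← hξ]
          exact hlim'.inner tendsto_const_nhds
        refine tendsto_nhds_unique h4 ((h5.congr fun n => ?_).trans (le_of_eq ?_))
        · simp only [hι, UniformSpace.Completion.inner_coe]
          change f _ = f _
          congr 1
          exact (by rw [star_mul, mul_assoc] :
            star ((toPreGNS hp).symm (y n)) * (star z * (toPreGNS hp).symm x)
              = star (z * (toPreGNS hp).symm (y n)) * (toPreGNS hp).symm x)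
        · simp only [Function.comp_apply, hι, UniformSpace.Completion.inner_coe]
          rfl
      exact ext_inner_right ℂ fun x => congrFun h3 x
    rw [h2] at h1
    have h3 := (h1.sub_const (ι (toPreGNS hp z))).norm.pow 2
    rw [sub_self, norm_zero, zero_pow two_ne_zero] at h3
    refine h3.congr fun n => ?_
    rw [← map_sub, hι, UniformSpace.Completion.norm_coe, hT, ← map_sub, norm_toPreGNS_sq]

/-- A positive form dominated by `f` sees the approximants of the cyclic vector of `f` as
approximate units; this is where an approximate identity of `A` is needed. -/
theorem IsPositiveForm.tendsto_of_dominated (hA : HasApproximateIdentity A)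
    {f p : StrongDual ℂ A} (hp : IsPositiveForm p) (hfp : IsPositiveForm (f - p)) {y : ℕ → A}
    {B : ℝ} (hB : ∀ n, (f (star (y n) * y n)).re ≤ B)
    (hy : ∀ z, Tendsto (fun n => (f (star (z * y n - z) * (z * y n - z))).re) atTop (𝓝 0))
    (x : A) : Tendsto (fun n => p (star (y n) * x)) atTop (𝓝 (p x)) := by
  have hle : ∀ z, (p (star z * z)).re ≤ (f (star z * z)).re := fun z => by
    have := (hfp z).1
    simp only [sub_apply, Complex.sub_re] at this
    linarith
  have hB0 : 0 ≤ B := ((hp _).1.trans (hle _)).trans (hB 0)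
  -- the functionals `x ↦ p (yₙ* x) - p x` are equibounded and tend to zero at every `z* u`
  let L : ℕ → A →ₗ[ℂ] ℂ := fun n =>
    p.toLinearMap ∘ₗ LinearMap.mulLeft ℂ (star (y n)) - p.toLinearMap
  have hL : ∀ n x, L n x = p (star (y n) * x) - p x := fun n x => rfl
  have hLn : ∀ n x, ‖L n x‖ ≤ (Real.sqrt (B * ‖p‖) + ‖p‖) * ‖x‖ := by
    intro n x
    rw [hL, add_mul]
    refine (norm_sub_le _ _).trans (add_le_add ?_ (p.le_opNorm x))
    rw [← Real.sqrt_sq (norm_nonneg x), ← Real.sqrt_mul (by positivity)]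
    refine Real.le_sqrt_of_sq_le ((hp.norm_sq_le x (y n)).trans ?_)
    rw [mul_assoc]
    refine mul_le_mul ((hle _).trans (hB n)) ?_ (hp x).1 hB0
    refine (Complex.re_le_norm _).trans ((p.le_opNorm _).trans ?_)
    refine mul_le_mul_of_nonneg_left ((norm_mul_le _ _).trans (le_of_eq ?_)) (norm_nonneg _)
    rw [norm_star, sq]
  obtain ⟨l, hl⟩ := hA
  have := hl.neBot
  have hx : x ∈ (Submodule.span ℂ
      (Set.range fun q : A × A => star q.1 * q.2)).topologicalClosure := by
    refine mem_closure_of_tendsto (hl.tendsto_mul_right x) (Eventually.of_forall fun e => ?_)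
    exact Submodule.subset_span ⟨(star e, x), by simp⟩
  have key := tendsto_seminorm_of_mem_closure_span (fun n => (normSeminorm ℂ ℂ).comp (L n)) _
    (fun n x => hLn n x) _ ?_ hx
  · rw [tendsto_iff_norm_sub_tendsto_zero]
    exact key
  · rintro _ ⟨⟨z, u⟩, rfl⟩
    have h1 : Tendsto (fun n => Real.sqrt ((f (star (z * y n - z) * (z * y n - z))).re
        * (p (star u * u)).re)) atTop (𝓝 0) := by
      have := (Real.continuous_sqrt.tendsto _).comp ((hy z).mul_const (p (star u * u)).re)
      rw [zero_mul, Real.sqrt_zero] at this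
      exact this
    refine squeeze_zero (fun n => apply_nonneg _ _) (fun n => ?_) h1
    change ‖L n (star z * u)‖ ≤ _
    refine Real.le_sqrt_of_sq_le ?_
    have e : L n (star z * u) = p (star (z * y n - z) * u) := by
      rw [hL, ← map_sub, star_sub, sub_mul, star_mul, mul_assoc]
    rw [e]
    exact (hp.norm_sq_le _ _).trans (mul_le_mul_of_nonneg_right (hle _) (hp u).1)

/-- The constants of the two summands in a decomposition `f = g + (f - g)` of a quasi-state into
positive forms can be chosen to add up to one; this replaces additivity of the norm. -/
theorem IsQuasiState.exists_split (hA : HasApproximateIdentity A)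
    {f g : StrongDual ℂ A} (hf : IsQuasiState f) (hg : IsPositiveForm g)
    (hfg : IsPositiveForm (f - g)) :
    ∃ C : ℝ, 0 ≤ C ∧ C ≤ 1 ∧ (∀ x, ‖g x‖ ^ 2 ≤ C * (g (star x * x)).re) ∧
      ∀ x, ‖(f - g) x‖ ^ 2 ≤ (1 - C) * ((f - g) (star x * x)).re := by
  obtain ⟨y, ρ, hρ, hlim, hy⟩ := hf.exists_seq
  obtain ⟨B, hB⟩ := hlim.bddAbove_range
  have hB' : ∀ n, (f (star (y n) * y n)).re ≤ B := fun n => hB ⟨n, rfl⟩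
  have hsub : ∀ x, ((f - g) x).re = (f x).re - (g x).re := fun x => by simp
  have hle : ∀ n, (g (star (y n) * y n)).re ∈ Set.Icc 0 B := fun n => by
    have := (hfg (y n)).1
    rw [hsub] at this
    exact ⟨(hg _).1, by linarith [hB' n]⟩
  -- `g (yₙ* yₙ)` is bounded by `f (yₙ* yₙ)`, so it converges to some `C` along a subsequence
  obtain ⟨C, hC, θ, hθ, hCθ⟩ := isCompact_Icc.tendsto_subseq hle
  have hlimθ := hlim.comp hθ.tendsto_atTop
  have hfg' : Tendsto (fun n => ((f - g) (star (y (θ n)) * y (θ n))).re) atTop (𝓝 (ρ - C)) :=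
    (hlimθ.sub hCθ).congr fun n => by rw [hsub]; rfl
  have hCρ : 0 ≤ ρ - C := ge_of_tendsto' hfg' fun n => (hfg _).1
  have main : ∀ (p : StrongDual ℂ A) (c : ℝ), IsPositiveForm p → IsPositiveForm (f - p) →
      Tendsto (fun n => (p (star (y (θ n)) * y (θ n))).re) atTop (𝓝 c) →
      ∀ x, ‖p x‖ ^ 2 ≤ c * (p (star x * x)).re := by
    intro p c hp hfp hpc x
    have h1 := (hp.tendsto_of_dominated hA hfp hB' hy x).comp hθ.tendsto_atTop
    exact le_of_tendsto_of_tendsto' (h1.norm.pow 2) (hpc.mul_const _) fun n =>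
      hp.norm_sq_le _ _
  refine ⟨C, hC.1, by linarith, main g C hg hfg hCθ, fun x => ?_⟩
  refine (main (f - g) (ρ - C) hfg (by rwa [sub_sub_cancel]) hfg' x).trans ?_
  exact mul_le_mul_of_nonneg_right (by linarith) (hfg x).1

/-! ### Extreme quasi-states and pure states -/

theorem eq_smul_of_dominated_of_extreme (hA : HasApproximateIdentity A) {f : StrongDual ℂ A}
    (hf : StrongDual.toWeakDual f ∈ (quasiStates A).extremePoints ℝ) {g : StrongDual ℂ A}
    (hg : IsPositiveForm g) (hfg : IsPositiveForm (f - g)) :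
    ∃ t : ℝ, 0 ≤ t ∧ t ≤ 1 ∧ g = (t : ℂ) • f := by
  have hfq : IsQuasiState f := hf.1
  obtain ⟨C, hC0, hC1, h1, h2⟩ := hfq.exists_split hA hg hfg
  have hzero : ∀ p : StrongDual ℂ A, (∀ x, ‖p x‖ ^ 2 ≤ 0 * (p (star x * x)).re) → p = 0 := by
    intro p hp
    ext x
    have := hp x
    rw [zero_mul] at this
    simpa using this.antisymm (sq_nonneg _)
  refine ⟨C, hC0, hC1, ?_⟩
  -- for `0 < C < 1`, `f` is a proper convex combination of `g / C` and `(f - g) / (1 - C)`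
  rcases hC0.eq_or_lt with rfl | hpos
  · rw [hzero g h1, Complex.ofReal_zero]
    exact (zero_smul ℂ f).symm
  rcases hC1.eq_or_lt with rfl | hlt
  · rw [sub_self] at h2
    rw [Complex.ofReal_one, one_smul]
    exact (sub_eq_zero.mp (hzero _ h2)).symm
  have hlt' : 0 < 1 - C := sub_pos.mpr hlt
  have hp := isQuasiState_smul hg hpos h1
  have hq := isQuasiState_smul hfg hlt' h2
  have hCc : (C : ℂ) ≠ 0 := by exact_mod_cast hpos.ne'
  have hCc' : ((1 - C : ℝ) : ℂ) ≠ 0 := by exact_mod_cast hlt'.ne'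
  have e : StrongDual.toWeakDual (((C⁻¹ : ℝ) : ℂ) • g) = StrongDual.toWeakDual f := by
    refine ((mem_extremePoints.mp hf).2 _ hp _ hq ⟨C, 1 - C, hpos, hlt', by ring, ?_⟩).1
    refine ContinuousLinearMap.ext fun x => ?_
    change (C : ℂ) * (((C⁻¹ : ℝ) : ℂ) * g x) + ((1 - C : ℝ) : ℂ) *
      ((((1 - C)⁻¹ : ℝ) : ℂ) * (f x - g x)) = f x
    rw [Complex.ofReal_inv, Complex.ofReal_inv, mul_inv_cancel_left₀ hCc,
      mul_inv_cancel_left₀ hCc']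
    ring
  rw [← StrongDual.toWeakDual.injective e, smul_smul, Complex.ofReal_inv, mul_inv_cancel₀ hCc,
    one_smul]

/-- The multiple of a nonzero extreme quasi-state that has norm one is a pure state. -/
theorem isPureState_of_extreme (hA : HasApproximateIdentity A) {f : StrongDual ℂ A}
    (hf : StrongDual.toWeakDual f ∈ (quasiStates A).extremePoints ℝ) (h0 : f ≠ 0) :
    IsPureState (((‖f‖⁻¹ : ℝ) : ℂ) • f) := by
  have hn : 0 < ‖f‖ := norm_pos_iff.mpr h0
  have hnc : ((‖f‖ : ℝ) : ℂ) ≠ 0 := by exact_mod_cast hn.ne'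
  have hpos : IsPositiveForm f := IsQuasiState.positive hf.1
  refine ⟨hpos.smul (inv_nonneg.mpr hn.le), ?_, fun g hg hfg => ?_⟩
  · rw [norm_smul, Complex.norm_real, Real.norm_of_nonneg (inv_nonneg.mpr hn.le),
      inv_mul_cancel₀ hn.ne']
  · have h1 : IsPositiveForm (f - ((‖f‖ : ℝ) : ℂ) • g) := by
      have := hfg.smul hn.le
      rwa [smul_sub, smul_smul, Complex.ofReal_inv, mul_inv_cancel₀ hnc, one_smul] at this
    obtain ⟨t, ht0, ht1, ht⟩ := eq_smul_of_dominated_of_extreme hA hf (hg.smul hn.le) h1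
    refine ⟨t, ht0, ht1, ?_⟩
    rw [smul_comm, ← ht, smul_smul, Complex.ofReal_inv, inv_mul_cancel₀ hnc, one_smul]

/-- Pure states separate the points of a reduced Banach `*`-algebra with approximate identity. -/
theorem pureStates_separate [CompleteSpace A] (hred : IsStarReduced A)
    (hA : HasApproximateIdentity A) (a : A) (h : ∀ f ∈ {f | IsPureState f}, f a = 0) : a = 0 := by
  by_contra ha
  obtain ⟨E, _, _, _, π, hπ⟩ := hred a ha
  -- over `ℂ`, an operator with vanishing quadratic form is zero
  obtain ⟨ξ, hξ⟩ : ∃ ξ : E, inner ℂ ξ (π a ξ) ≠ 0 := by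
    by_contra! hcon
    refine hπ (ContinuousLinearMap.coe_injective ((inner_map_self_eq_zero (π a).toLinearMap).mp
      fun ξ => ?_))
    rw [← inner_conj_symm]
    exact (congrArg _ (hcon ξ)).trans (map_zero _)
  have hξ0 : 0 < ‖ξ‖ := norm_pos_iff.mpr fun h0 => hξ (by rw [h0, inner_zero_left])
  have hξc : ((‖ξ‖⁻¹ : ℝ) : ℂ) ≠ 0 := by exact_mod_cast inv_ne_zero hξ0.ne'
  have hq : IsQuasiState (vectorForm π (((‖ξ‖⁻¹ : ℝ) : ℂ) • ξ)) := by
    refine isQuasiState_vectorForm π (le_of_eq ?_)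
    rw [norm_smul, Complex.norm_real, Real.norm_of_nonneg (inv_nonneg.mpr hξ0.le),
      inv_mul_cancel₀ hξ0.ne']
  obtain ⟨g, hg, hga⟩ := exists_extremePoint_ne_zero hq (a := a) (by
    rw [vectorForm_apply, map_smul, inner_smul_left, inner_smul_right]
    exact mul_ne_zero ((map_ne_zero _).mpr hξc) (mul_ne_zero hξc hξ))
  set g' : StrongDual ℂ A := WeakDual.toStrongDual g with hg'
  have hga' : g' a ≠ 0 := hga
  have hg0 : g' ≠ 0 := fun h0 => hga' (by rw [h0]; rfl)
  have hz := h _ (isPureState_of_extreme hA (f := g') hg hg0)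
  rw [smul_apply, smul_eq_zero] at hz
  rcases hz with hz | hz
  · exact inv_ne_zero (norm_ne_zero_iff.mpr hg0) (by exact_mod_cast hz)
  · exact hga' hz

end PureStates

end Haagerup

end

theorem mainTheorem11 :
    -- operator spaces: both families of slice maps separate the points
    (∀ (V W H K : Type*)
        [NormedAddCommGroup V] [NormedSpace ℂ V] [CompleteSpace V]
        [NormedAddCommGroup W] [NormedSpace ℂ W] [CompleteSpace W]
        [NormedAddCommGroup H] [InnerProductSpace ℂ H] [CompleteSpace H]
        [NormedAddCommGroup K] [InnerProductSpace ℂ K] [CompleteSpace K]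
        (jV : Haagerup.OperatorSpaceStructure V H) (jW : Haagerup.OperatorSpaceStructure W K),
      (∀ y z : Haagerup.HaagerupTensor jV jW,
        (∀ φ : StrongDual ℂ V, Haagerup.rightSlice jV jW φ y = Haagerup.rightSlice jV jW φ z) →
          y = z) ∧
      (∀ y z : Haagerup.HaagerupTensor jV jW,
        (∀ ψ : StrongDual ℂ W, Haagerup.leftSlice jV jW ψ y = Haagerup.leftSlice jV jW ψ z) →
          y = z)) ∧
    -- `V` a reduced Banach `*`-algebra with approximate identity
    (∀ (V W H K : Type*)
        [NonUnitalNormedRing V] [NormedSpace ℂ V] [IsScalarTower ℂ V V] [SMulCommClass ℂ V V]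
        [CompleteSpace V] [StarRing V] [StarModule ℂ V] [NormedStarGroup V]
        [NormedAddCommGroup W] [NormedSpace ℂ W] [CompleteSpace W]
        [NormedAddCommGroup H] [InnerProductSpace ℂ H] [CompleteSpace H]
        [NormedAddCommGroup K] [InnerProductSpace ℂ K] [CompleteSpace K]
        (jV : Haagerup.OperatorSpaceStructure V H) (jW : Haagerup.OperatorSpaceStructure W K),
      Haagerup.IsStarReduced V → Haagerup.HasApproximateIdentity V →
      ∀ y z : Haagerup.HaagerupTensor jV jW,
        (∀ φ : StrongDual ℂ V, Haagerup.IsPureState φ →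
          Haagerup.rightSlice jV jW φ y = Haagerup.rightSlice jV jW φ z) → y = z) ∧
    -- `W` a reduced Banach `*`-algebra with approximate identity
    (∀ (V W H K : Type*)
        [NormedAddCommGroup V] [NormedSpace ℂ V] [CompleteSpace V]
        [NonUnitalNormedRing W] [NormedSpace ℂ W] [IsScalarTower ℂ W W] [SMulCommClass ℂ W W]
        [CompleteSpace W] [StarRing W] [StarModule ℂ W] [NormedStarGroup W]
        [NormedAddCommGroup H] [InnerProductSpace ℂ H] [CompleteSpace H]
        [NormedAddCommGroup K] [InnerProductSpace ℂ K] [CompleteSpace K]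
        (jV : Haagerup.OperatorSpaceStructure V H) (jW : Haagerup.OperatorSpaceStructure W K),
      Haagerup.IsStarReduced W → Haagerup.HasApproximateIdentity W →
      ∀ y z : Haagerup.HaagerupTensor jV jW,
        (∀ ψ : StrongDual ℂ W, Haagerup.IsPureState ψ →
          Haagerup.leftSlice jV jW ψ y = Haagerup.leftSlice jV jW ψ z) → y = z) := by
  refine ⟨?_, ?_, ?_⟩
  · intro V W H K _ _ _ _ _ _ _ _ _ _ _ _ jV jW
    exact ⟨fun y z h => Haagerup.rightSlice_separates jV jW Set.univ
        (fun x hx => SeparatingDual.eq_zero_of_forall_dual_eq_zero (R := ℂ) fun φ => hx φ trivial)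
        y z fun φ _ => h φ,
      fun y z h => Haagerup.leftSlice_separates jV jW Set.univ
        (fun x hx => SeparatingDual.eq_zero_of_forall_dual_eq_zero (R := ℂ) fun φ => hx φ trivial)
        y z fun ψ _ => h ψ⟩
  · intro V W H K _ _ _ _ _ _ _ _ _ _ _ _ _ _ _ _ _ jV jW hred hai y z h
    exact Haagerup.rightSlice_separates jV jW {φ | Haagerup.IsPureState φ}
      (Haagerup.pureStates_separate hred hai) y z h
  · intro V W H K _ _ _ _ _ _ _ _ _ _ _ _ _ _ _ _ _ jV jW hred hai y z h
    exact Haagerup.leftSlice_separates jV jW {ψ | Haagerup.IsPureState ψ}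
      (Haagerup.pureStates_separate hred hai) y z h
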